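/- Consider the Schrödinger equation $$\mathrm{i}\,\partial_t\psi(t,x)=\bigl(-\Delta+\omega(t)x^2\bigr)\psi(t,x),\qquad x\in\mathbb R. \tag{1}$$ A \emph{solution} of (1) on $[0,T]$ is a map $\psi\in C([0,T];L^2(\mathbb R,\mathbb C))$ such that for every Schwartz function $\varphi$ and every $t\in[0,T]$, $$\int_{\mathbb R}\varphi\,\psi(t)\,dx=\int_{\mathbb R}\varphi\,\psi(0)\,dx-\mathrm{i}\int_0^t\int_{\mathbb R}\bigl(-\varphi''+\omega(s)x^2\varphi\bigr)\,\psi(s)\,dx\,ds .$$ If $u:[0,T]\to(0,+\infty)$ is piecewise constant, equal to $c_k$ on $(\tau_k,\tau_{k+1})$ with $0=\tau_0<\dots<\tau_n=T$, its propagator $\Upsilon^u_t$ is the concatenation of the unitary groups $e^{-\mathrm{i}t(-\Delta+c_kx^2)}$ of $L^2(\mathbb R,\mathbb C)$, that is, $\Upsilon^u_0=\mathrm{Id}$ and $\Upsilon^u_t=e^{-\mathrm{i}(t-\tau_k)(-\Delta+c_kx^2)}\Upsilon^u_{\tau_k}$ for $t\in[\tau_k,\tau_{k+1}]$. \textbf{Proposition.}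 Let $\psi_0\in L^2(\mathbb R,\mathbb C)$ be even, let $T>0$ and $\alpha>0$, and let $\omega:[0,T]\to(\alpha,+\infty)$ have bounded variation. Then (1) has a solution $\psi:t\mapsto\Upsilon^\omega_t\psi_0$ on $[0,T]$ with $\psi(0)=\psi_0$, and it is the only one; moreover $\psi(t)$ is even for every $t\in[0,T]$. Here $\Upsilon^\omega_t\psi_0$ is the limit in $L^2$ of the propagators of piecewise constant frequencies: there exist sequences $(u_n)$ of piecewise constant functions $u_n:[0,T]\to(\alpha,+\infty)$ with $TV_{[0,T]}(u_n)\le TV_{[0,T]}(\omega)$ for every $n$ and $u_n\to\omega$ almost everywhere on $[0,T]$, and for every such sequence, $\Upsilon^{u_n}_t\psi_0\to\psi(t)$ in $L^2(\mathbb R,\mathbb C)$ for every $t\in[0,T]$. -/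

import Mathlib

noncomputable section

namespace HarmonicTrap

open MeasureTheory Filter Topology

/-- The complex Hilbert space `L²(ℝ, ℂ)` for the Lebesgue measure. -/
abbrev L2 : Type := Lp ℂ 2 (volume : Measure ℝ)

/-- The class `ψ` of square integrable functions is even. -/
def IsEven (ψ : L2) : Prop := ∀ᵐ x : ℝ, ψ (-x) = ψ x

/-- The (bilinear) pairing `∫ f(x) ψ(x) dx` of a function with an element of `L²`. -/
def pairing (f : ℝ → ℂ) (ψ : L2) : ℂ := ∫ x : ℝ, f x * ψ x

/-- The differential expression `(-Δ + c x²) φ` for a Schwartz function `φ`. -/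
def harmonicExpr (c : ℝ) (φ : SchwartzMap ℝ ℂ) : ℝ → ℂ :=
  fun x => -deriv (deriv φ) x + (c : ℂ) * (x : ℂ) ^ 2 * φ x

/-- `ψ` is in the domain of the operator `-Δ + c x²` on `L²(ℝ, ℂ)`, and `(-Δ + c x²) ψ = g`,
the left-hand side being taken in the sense of tempered distributions.
For `c > 0` this is the graph of the usual self-adjoint harmonic oscillator. -/
def IsHarmonicImage (c : ℝ) (ψ g : L2) : Prop :=
  ∀ φ : SchwartzMap ℝ ℂ, pairing (harmonicExpr c φ) ψ = pairing φ g

/-- `ψ : [0,T] → L²(ℝ, ℂ)` is a solution of `i ∂ₜψ = (-Δ + ω(t) x²) ψ`: it is continuous with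
values in `L²`, and it satisfies the time-integrated equation in the sense of tempered
distributions in the space variable. Only the values on `[0,T]` are relevant. -/
structure IsSolution (T : ℝ) (ω : ℝ → ℝ) (ψ : ℝ → L2) : Prop where
  continuousOn : ContinuousOn ψ (Set.Icc 0 T)
  equation : ∀ φ : SchwartzMap ℝ ℂ, ∀ t ∈ Set.Icc 0 T,
    pairing φ (ψ t) = pairing φ (ψ 0)
      - Complex.I * ∫ s in (0 : ℝ)..t, pairing (harmonicExpr (ω s) φ) (ψ s)

/-- `U` is the strongly continuous unitary group `t ↦ exp(-i t (-Δ + c x²))`, i.e. the one whose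
infinitesimal generator is exactly `-i (-Δ + c x²)`. -/
structure IsHarmonicGroup (c : ℝ) (U : ℝ → L2 ≃ₗᵢ[ℂ] L2) : Prop where
  map_add : ∀ (s t : ℝ) (ψ : L2), U (s + t) ψ = U s (U t ψ)
  continuous : ∀ ψ : L2, Continuous fun t => U t ψ
  generator : ∀ ψ g : L2,
    IsHarmonicImage c ψ g ↔ HasDerivAt (fun t => U t ψ) (-(Complex.I • g)) 0

/-- `0 = τ 0 < τ 1 < ⋯ < τ n = T`, and `u` is equal to `c k` on `(τ k, τ (k+1))` for `k < n`. -/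
structure IsStepData (T : ℝ) (u : ℝ → ℝ) (n : ℕ) (τ : ℕ → ℝ) (c : ℕ → ℝ) : Prop where
  zero : τ 0 = 0
  last : τ n = T
  lt : ∀ k < n, τ k < τ (k + 1)
  value : ∀ k < n, ∀ t ∈ Set.Ioo (τ k) (τ (k + 1)), u t = c k

/-- `u` is piecewise constant on `[0,T]`. -/
def IsPiecewiseConstant (T : ℝ) (u : ℝ → ℝ) : Prop :=
  ∃ (n : ℕ) (τ c : ℕ → ℝ), IsStepData T u n τ c

/-- `ψ` is the curve `t ↦ Υᵘ_t ψ(0)` on `[0,T]`, where the propagator `Υᵘ` associated with the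
piecewise constant frequency `u` is the concatenation of the unitary groups
`exp(-i t (-Δ + cₖ x²))`. -/
def IsPiecewiseConstantEvolution (T : ℝ) (u : ℝ → ℝ) (ψ : ℝ → L2) : Prop :=
  ∃ (n : ℕ) (τ c : ℕ → ℝ) (U : ℕ → ℝ → L2 ≃ₗᵢ[ℂ] L2),
    IsStepData T u n τ c ∧
    (∀ k < n, IsHarmonicGroup (c k) (U k)) ∧
    ∀ k < n, ∀ t ∈ Set.Icc (τ k) (τ (k + 1)), ψ t = U k (t - τ k) (ψ (τ k))

/-- `(u n)` is a sequence of piecewise constant functions `[0,T] → (α, ∞)`, of total variation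
not larger than that of `ω`, which tends to `ω` almost everywhere on `[0,T]`. -/
structure IsApproximation (T α : ℝ) (ω : ℝ → ℝ) (u : ℕ → ℝ → ℝ) : Prop where
  piecewiseConstant : ∀ n, IsPiecewiseConstant T (u n)
  gt : ∀ n, ∀ t ∈ Set.Icc 0 T, α < u n t
  variation_le : ∀ n, eVariationOn (u n) (Set.Icc 0 T) ≤ eVariationOn ω (Set.Icc 0 T)
  tendsto : ∀ᵐ t : ℝ, t ∈ Set.Icc 0 T → Tendsto (fun n => u n t) atTop (𝓝 (ω t))

/-- `ψ` is the curve `t ↦ Υ^ω_t ψ₀` on `[0,T]`, where `Υ^ω_t ψ₀` is the limit of `Υ^(u n)_t ψ₀`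
for sequences `(u n)` of piecewise constant functions that approximate `ω`: there are
such sequences, and all of them lead to the limit `ψ`. -/
structure IsPropagatorCurve (T α : ℝ) (ω : ℝ → ℝ) (ψ₀ : L2) (ψ : ℝ → L2) : Prop where
  exists_approximation : ∃ u : ℕ → ℝ → ℝ, IsApproximation T α ω u
  limit : ∀ u : ℕ → ℝ → ℝ, IsApproximation T α ω u →
    ∃ χ : ℕ → ℝ → L2,
      (∀ n, IsPiecewiseConstantEvolution T (u n) (χ n) ∧ χ n 0 = ψ₀) ∧
      ∀ t ∈ Set.Icc 0 T, Tendsto (fun n => χ n t) atTop (𝓝 (ψ t))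

end HarmonicTrap

end

noncomputable section

namespace HarmonicTrap

open MeasureTheory Filter Topology
open scoped SchwartzMap FourierTransform

/-! Gaussians stay Gaussian under a quadratic Hamiltonian. The function `exp (A x² + B x + C)`
solves the equation when `A' = i (4 A² - ω)`, `B' = 4 i A B` and `C' = i (B² + 2 A)`. The Riccati
equation is linearised by `A = (i/4) y'/y` with `y'' = -4 ω y`. For `y(0) = 1`, `y'(0) = 2i` the
conserved Wronskian `Im (conj y · y') = 2` keeps `y` away from zero and gives `Re A = -1/(2 |y|²) <
0`, so these solutions are global (`exists_gaussianFlow`). At each time `B` takes every complex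
value, and Gaussians with a fixed `A` and arbitrary `B` are total in `L²` by Fourier injectivity
(`exists_total_strongCurves`).

Everything else is duality with this family. The conjugate Gaussians solve the time-reversed
equation, and the pairing of a weak solution of frequency `u` with one of them, of frequency `ω`,
changes only by the integral of `(u - ω) ∫ x² g χ` (`IsWeakSolutionOn.pairing_strongCurve`). If `u =
ω`, the pairing is constant. This yields uniqueness; it also shows that the Gram matrix of the
Gaussians is constant in time, so they are moved by linear isometries, which form the propagator
(`exists_propagator`). Weak solutions therefore conserve the norm. If `u n → ω` in `L¹`, the formula
gives weak convergence, and equality of norms makes it strong (`IsWeakSolutionOn.tendsto`).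

For a constant frequency, uniqueness produces the unitary group with the required generator, and on
each step it identifies the solution with the concatenation of these groups. Evenness holds because
the reflected solution solves the same problem. Bounded variation supplies measurability,
boundedness and, along approximating sequences, the domination behind `L¹` convergence.

As `ω` is only measurable, `A` need not be differentiable everywhere. Adding a multiple of the
primitive of `ω` restores an everywhere defined derivative, so that vanishing derivatives do give
constants. -/

/-! ### Integral equations with a bounded measurable coefficient -/

/-- A measurable bounded frequency, defined for all times. -/
structure IsFrequency (ω : ℝ → ℝ) : Prop where
  aemeasurable : AEMeasurable ω
  bounded : ∃ K, 0 < K ∧ ∀ t, |ω t| ≤ K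

lemma IsFrequency.const (c : ℝ) : IsFrequency fun _ => c :=
  ⟨aemeasurable_const, |c| + 1, by positivity, fun _ => by linarith⟩

lemma IsFrequency.intervalIntegrable_mul {ω : ℝ → ℝ} (hω : IsFrequency ω) {k : ℝ → ℂ} {a b : ℝ}
    (hk : ContinuousOn k (Set.uIcc a b)) :
    IntervalIntegrable (fun r => (ω r : ℂ) * k r) volume a b := by
  obtain ⟨K, -, hK⟩ := hω.bounded
  have hk' : IntervalIntegrable k volume a b := hk.intervalIntegrable
  rw [intervalIntegrable_iff] at hk' ⊢
  refine hk'.bdd_mul (c := K) ?_ ?_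
  · exact (Complex.measurable_ofReal.comp_aemeasurable
      hω.aemeasurable.restrict).aestronglyMeasurable
  · exact Eventually.of_forall fun x => by simpa using hK x

lemma IsFrequency.intervalIntegrable {ω : ℝ → ℝ} (hω : IsFrequency ω) (a b : ℝ) :
    IntervalIntegrable ω volume a b := by
  obtain ⟨K, -, hK⟩ := hω.bounded
  have hc : IntervalIntegrable (fun _ : ℝ => K) volume a b := intervalIntegrable_const
  refine hc.mono_fun hω.aemeasurable.restrict.aestronglyMeasurable ?_
  exact Eventually.of_forall fun x => by simpa using (hK x).trans (le_abs_self K)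

lemma IsFrequency.intervalIntegrable_ofReal {ω : ℝ → ℝ} (hω : IsFrequency ω) (a b : ℝ) :
    IntervalIntegrable (fun r => (ω r : ℂ)) volume a b := by
  simpa using hω.intervalIntegrable_mul (k := fun _ => 1) (a := a) (b := b) continuousOn_const

/-- Differentiation of `∫₀ᵗ u k` with the continuous factor `k` frozen. -/
theorem hasDerivWithinAt_integral_mul_sub {u : ℝ → ℝ} (hu : IsFrequency u) {k : ℝ → ℂ} {S : Set ℝ}
    (hS : S.OrdConnected) (h0 : (0 : ℝ) ∈ S) (hk : ContinuousOn k S) {s : ℝ} (hs : s ∈ S) :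
    HasDerivWithinAt (fun t => (∫ r in (0 : ℝ)..t, (u r : ℂ) * k r)
      - (∫ r in (0 : ℝ)..t, (u r : ℂ)) * k s) 0 S s := by
  obtain ⟨K, hK0, hK⟩ := hu.bounded
  rw [hasDerivWithinAt_iff_isLittleO, Asymptotics.isLittleO_iff]
  intro ε hε
  have hc := Metric.continuousWithinAt_iff.1 (hk s hs) (ε / K) (by positivity)
  obtain ⟨δ, hδ, hδk⟩ := hc
  have hmem : ∀ᶠ t in 𝓝[S] s, t ∈ S ∧ dist t s < δ :=
    eventually_mem_nhdsWithin.and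
      (eventually_nhdsWithin_of_eventually_nhds (Metric.ball_mem_nhds s hδ))
  filter_upwards [hmem] with t ⟨htS, htδ⟩
  have hint : ∀ a ∈ S, ∀ b ∈ S, IntervalIntegrable (fun r => (u r : ℂ) * k r) volume a b :=
    fun a ha b hb => hu.intervalIntegrable_mul (hk.mono (hS.uIcc_subset ha hb))
  have hint1 : ∀ a b : ℝ, IntervalIntegrable (fun r => (u r : ℂ)) volume a b :=
    hu.intervalIntegrable_ofReal
  -- The increment is `∫ u (k - k s)` over `[s, t]`, which is `o(t - s)` because `u` is bounded and
  -- `k` is continuous at `s`; no regularity of `u` enters.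
  have e : (∫ r in (0 : ℝ)..t, (u r : ℂ) * k r) - (∫ r in (0 : ℝ)..t, (u r : ℂ)) * k s -
      ((∫ r in (0 : ℝ)..s, (u r : ℂ) * k r) - (∫ r in (0 : ℝ)..s, (u r : ℂ)) * k s)
      - (t - s) • (0 : ℂ) = ∫ r in s..t, (u r : ℂ) * (k r - k s) := by
    rw [← intervalIntegral.integral_add_adjacent_intervals (hint 0 h0 s hs) (hint s hs t htS),
      ← intervalIntegral.integral_add_adjacent_intervals (hint1 0 s) (hint1 s t)]
    simp only [mul_sub]
    rw [intervalIntegral.integral_sub (hint s hs t htS) ((hint1 s t).mul_const _),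
      intervalIntegral.integral_mul_const]
    simp
    ring
  rw [e]
  have hb : ∀ r ∈ Set.uIoc s t, ‖(u r : ℂ) * (k r - k s)‖ ≤ ε := by
    intro r hr
    have hr' := Set.uIoc_subset_uIcc hr
    have hrS : r ∈ S := hS.uIcc_subset hs htS hr'
    have hrd : dist r s < δ := by
      refine lt_of_le_of_lt ?_ htδ
      rw [Real.dist_eq, Real.dist_eq]
      exact Set.abs_sub_left_of_mem_uIcc hr'
    have := (hδk hrS hrd).le
    rw [dist_eq_norm] at this
    calc ‖(u r : ℂ) * (k r - k s)‖ = |u r| * ‖k r - k s‖ := by simp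
      _ ≤ K * (ε / K) := by gcongr; exact hK r
      _ = ε := by field_simp
  simpa using intervalIntegral.norm_integral_le_of_norm_le_const hb

theorem hasDerivWithinAt_integral_of_continuousOn {k : ℝ → ℂ} {S : Set ℝ}
    (hS : S.OrdConnected) (h0 : (0 : ℝ) ∈ S) (hk : ContinuousOn k S) {s : ℝ} (hs : s ∈ S) :
    HasDerivWithinAt (fun t => ∫ r in (0 : ℝ)..t, k r) (k s) S s := by
  have h := hasDerivWithinAt_integral_mul_sub (IsFrequency.const 1) hS h0 hk hs
  have h2 : HasDerivWithinAt (fun t : ℝ => ((t : ℂ)) * k s) (1 * k s) S s :=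
    ((hasDerivAt_id s).ofReal_comp.mul_const (k s)).hasDerivWithinAt
  have h3 := h.add h2
  simp only [zero_add, one_mul] at h3
  refine h3.congr_of_mem (fun t _ => ?_) hs
  simp [Pi.add_apply]

lemma abs_integral_exp_mul_abs_le {L : ℝ} (hL : 0 < L) (t : ℝ) :
    |∫ s in (0 : ℝ)..t, Real.exp (L * |s|)| ≤ Real.exp (L * |t|) / L := by
  have key : ∀ t : ℝ, 0 ≤ t → |∫ s in (0 : ℝ)..t, Real.exp (L * |s|)| ≤ Real.exp (L * t) / L := by
    intro t ht
    have : ∫ s in (0 : ℝ)..t, Real.exp (L * |s|) = ∫ s in (0 : ℝ)..t, Real.exp (L * s) := by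
      refine intervalIntegral.integral_congr fun s hs => ?_
      rw [Set.uIcc_of_le ht] at hs
      simp only [abs_of_nonneg hs.1]
    rw [this, intervalIntegral.integral_comp_mul_left _ hL.ne', integral_exp]
    have h1 : 1 ≤ Real.exp (L * t) := Real.one_le_exp (by positivity)
    rw [smul_eq_mul, abs_mul, abs_of_pos (inv_pos.2 hL), mul_zero, Real.exp_zero,
      abs_of_nonneg (by linarith), inv_mul_eq_div]
    gcongr
    linarith
  rcases le_total 0 t with ht | ht
  · rw [abs_of_nonneg ht]; exact key t ht
  · rw [abs_of_nonpos ht]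
    have h := key (-t) (by linarith)
    have e : ∫ s in (0 : ℝ)..(-t), Real.exp (L * |s|) = -∫ s in (0 : ℝ)..t, Real.exp (L * |s|) := by
      have := intervalIntegral.integral_comp_neg (fun s => Real.exp (L * |s|)) (a := 0) (b := t)
      simp only [abs_neg, neg_zero] at this
      rw [this, intervalIntegral.integral_symm]
    rwa [e, abs_neg] at h

/-- Global solvability of linear integral equations with bounded measurable coefficients. -/
theorem exists_continuous_eq_add_integral {E : Type*} [NormedAddCommGroup E] [NormedSpace ℝ E]
    [CompleteSpace E] (N : ℝ → E →L[ℝ] E) {K : ℝ} (hK : 0 < K) (hN : ∀ t, ‖N t‖ ≤ K)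
    (hmeas : ∀ x : ℝ → E, Continuous x → AEStronglyMeasurable (fun s => N s (x s)) volume)
    (z₀ : E) :
    ∃ z : ℝ → E, Continuous z ∧ ∀ t, z t = z₀ + ∫ s in (0 : ℝ)..t, N s (z s) := by
  -- The weight `exp (-L |t|)` makes the Picard map a contraction on all of `ℝ` with ratio `K / L =
  -- 1/2`. The fixed point `x` below is the solution times this weight.
  set L : ℝ := 2 * K with hL
  have hL0 : 0 < L := by positivity
  have hexp : Continuous fun s : ℝ => Real.exp (L * |s|) := by fun_prop
  have hloc : ∀ x : ℝ → E, Continuous x → ∀ a b, IntervalIntegrable (fun s => N s (x s)) volume a b := by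
    intro x hx a b
    have h1 : IntervalIntegrable (fun s => K * ‖x s‖) volume a b :=
      (by fun_prop : Continuous fun s => K * ‖x s‖).intervalIntegrable a b
    refine h1.mono_fun (hmeas x hx).restrict (Eventually.of_forall fun s => ?_)
    simp only [norm_mul, norm_norm, Real.norm_of_nonneg hK.le]
    exact (N s).le_of_opNorm_le (hN s) _
  have hcts : ∀ x : ℝ → E, Continuous x → Continuous fun t => ∫ s in (0 : ℝ)..t, N s (x s) :=
    fun x hx => intervalIntegral.continuous_primitive (hloc x hx) 0
  have hest : ∀ x : BoundedContinuousFunction ℝ E, ∀ t,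
      Real.exp (-(L * |t|)) * ‖∫ s in (0 : ℝ)..t, N s (Real.exp (L * |s|) • x s)‖ ≤ 1 / 2 * ‖x‖ := by
    intro x t
    have h1 : ‖∫ s in (0 : ℝ)..t, N s (Real.exp (L * |s|) • x s)‖ ≤
        |∫ s in (0 : ℝ)..t, Real.exp (L * |s|) * (K * ‖x‖)| := by
      refine intervalIntegral.norm_integral_le_abs_of_norm_le (Eventually.of_forall fun s => ?_)
        ((by fun_prop : Continuous fun s : ℝ => Real.exp (L * |s|) * (K * ‖x‖)).intervalIntegrable _ _)
      rw [map_smul, norm_smul, Real.norm_of_nonneg (Real.exp_nonneg _)]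
      gcongr
      exact (N s).le_of_opNorm_le_of_le (hN s) (x.norm_coe_le_norm s)
    rw [intervalIntegral.integral_mul_const, abs_mul, abs_of_nonneg (by positivity : 0 ≤ K * ‖x‖)] at h1
    calc _ ≤ Real.exp (-(L * |t|)) * (Real.exp (L * |t|) / L * (K * ‖x‖)) := by
          gcongr
          exact h1.trans (by gcongr; exact abs_integral_exp_mul_abs_le hL0 t)
      _ = (Real.exp (-(L * |t|)) * Real.exp (L * |t|)) * (K / L) * ‖x‖ := by ring
      _ = 1 / 2 * ‖x‖ := by
          rw [← Real.exp_add]; simp [hL]; left; field_simp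
  have hwc : ∀ x : BoundedContinuousFunction ℝ E, Continuous fun s => Real.exp (L * |s|) • x s :=
    fun x => hexp.smul x.continuous
  let Φ : BoundedContinuousFunction ℝ E → BoundedContinuousFunction ℝ E := fun x =>
    BoundedContinuousFunction.ofNormedAddCommGroup
      (fun t => Real.exp (-(L * |t|)) • (z₀ + ∫ s in (0 : ℝ)..t, N s (Real.exp (L * |s|) • x s)))
      ((by fun_prop : Continuous fun t : ℝ => Real.exp (-(L * |t|))).smul
        (continuous_const.add (hcts _ (hwc x))))
      (‖z₀‖ + 1 / 2 * ‖x‖) (by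
        intro t
        rw [smul_add]
        refine (norm_add_le _ _).trans (add_le_add ?_ ?_)
        · rw [norm_smul, Real.norm_of_nonneg (Real.exp_nonneg _)]
          exact mul_le_of_le_one_left (norm_nonneg _) (Real.exp_le_one_iff.2 (by
            have : 0 ≤ L * |t| := by positivity
            linarith))
        · rw [norm_smul, Real.norm_of_nonneg (Real.exp_nonneg _)]
          exact hest x t)
  have hΦ : ContractingWith (1 / 2) Φ := by
    refine ⟨by rw [← NNReal.coe_lt_coe]; norm_num, LipschitzWith.of_dist_le_mul fun x x' => ?_⟩
    rw [BoundedContinuousFunction.dist_le (by positivity)]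
    intro t
    have e : Φ x t - Φ x' t
        = Real.exp (-(L * |t|)) • ∫ s in (0 : ℝ)..t, N s (Real.exp (L * |s|) • (x - x') s) := by
      simp only [Φ, BoundedContinuousFunction.coe_ofNormedAddCommGroup,
        BoundedContinuousFunction.coe_sub, Pi.sub_apply, smul_sub, map_sub]
      rw [intervalIntegral.integral_sub (hloc _ (hwc x) _ _) (hloc _ (hwc x') _ _), ← smul_sub]
      congr 1
      abel
    rw [dist_eq_norm, e, norm_smul, Real.norm_of_nonneg (Real.exp_nonneg _), dist_eq_norm]
    simpa using hest (x - x') t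
  set x := hΦ.fixedPoint Φ with hx
  have hfix : Φ x = x := hΦ.fixedPoint_isFixedPt
  refine ⟨fun s => Real.exp (L * |s|) • x s, hwc x, fun t => ?_⟩
  have h : Φ x t = x t := by rw [hfix]
  simp only [Φ, BoundedContinuousFunction.coe_ofNormedAddCommGroup] at h
  change Real.exp (L * |t|) • x t = _
  rw [← h, smul_smul, ← Real.exp_add]
  simp

/-- As `g` vanishes at `s`, the slope of the product is `f` times the slope of `g`. This is meant
for `f` the primitive of `ω`, which need not be differentiable. -/
lemma hasDerivAt_continuousAt_mul {f g : ℝ → ℂ} {s : ℝ} {g' : ℂ} (hf : ContinuousAt f s)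
    (hg : HasDerivAt g g' s) (hg0 : g s = 0) : HasDerivAt (fun t => f t * g t) (f s * g') s := by
  rw [hasDerivAt_iff_tendsto_slope] at hg ⊢
  have := (hf.tendsto.mono_left nhdsWithin_le_nhds).mul hg
  refine this.congr fun t => ?_
  simp [slope, hg0]
  ring

/-! ### The classical oscillator and the parameters of Gaussian solutions -/

/-- Solution of `y'' = -4 ω y`, `y(0) = 1`, `y'(0) = 2i`, for a measurable bounded `ω`. -/
theorem exists_oscillator {ω : ℝ → ℝ} (hω : IsFrequency ω) :
    ∃ y v : ℝ → ℂ, Continuous v ∧ y 0 = 1 ∧ v 0 = 2 * Complex.I ∧ (∀ t, HasDerivAt y (v t) t) ∧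
      ∀ t, v t = 2 * Complex.I - 4 * ∫ s in (0 : ℝ)..t, (ω s : ℂ) * y s := by
  obtain ⟨K, hK0, hK⟩ := hω.bounded
  let N : ℝ → ℂ × ℂ →L[ℝ] ℂ × ℂ := fun t =>
    (ContinuousLinearMap.snd ℝ ℂ ℂ).prod ((-4 * ω t) • ContinuousLinearMap.fst ℝ ℂ ℂ)
  have hNa : ∀ t p, N t p = (p.2, (-4 * ω t) • p.1) := fun t p => rfl
  obtain ⟨z, hz, hzi⟩ := exists_continuous_eq_add_integral N (K := 1 + 4 * K) (by positivity)
    (fun t => by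
      refine ContinuousLinearMap.opNorm_le_bound _ (by positivity) fun p => ?_
      rw [hNa, Prod.norm_mk]
      have h1 := norm_fst_le p
      have h2 := norm_snd_le p
      have h3 := hK t
      refine max_le ?_ ?_
      · nlinarith [norm_nonneg p]
      · rw [norm_smul]
        have : ‖-4 * ω t‖ ≤ 1 + 4 * K := by
          rw [norm_mul, Real.norm_eq_abs, Real.norm_eq_abs]; norm_num; linarith
        gcongr)
    (fun x hx => by
      simp only [hNa]
      refine AEStronglyMeasurable.prodMk (by fun_prop : Continuous fun s => (x s).2).aestronglyMeasurable ?_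
      exact (hω.aemeasurable.const_mul (-4)).aestronglyMeasurable.smul
        (by fun_prop : Continuous fun s => (x s).1).aestronglyMeasurable)
    ((1 : ℂ), 2 * Complex.I)
  have hint : ∀ t, IntervalIntegrable (fun s => N s (z s)) volume 0 t := by
    intro t
    rw [intervalIntegrable_iff]
    have h1 : IntervalIntegrable (fun s => (z s).2) volume 0 t :=
      (by fun_prop : Continuous fun s => (z s).2).intervalIntegrable _ _
    have h2 : IntervalIntegrable (fun s => (ω s : ℂ) * (z s).1) volume 0 t :=
      hω.intervalIntegrable_mul (by fun_prop)
    rw [intervalIntegrable_iff] at h1 h2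
    refine (h1.prodMk (h2.const_mul (-4))).congr (Eventually.of_forall fun s => ?_)
    simp [hNa, mul_assoc]
  have h1 : ∀ t, (z t).1 = 1 + ∫ s in (0 : ℝ)..t, (z s).2 := by
    intro t
    have h := congrArg (ContinuousLinearMap.fst ℝ ℂ ℂ) (hzi t)
    rw [map_add, ← ContinuousLinearMap.intervalIntegral_comp_comm _ (hint t)] at h
    simpa [hNa] using h
  have h2 : ∀ t, (z t).2 = 2 * Complex.I - 4 * ∫ s in (0 : ℝ)..t, (ω s : ℂ) * (z s).1 := by
    intro t
    have h := congrArg (ContinuousLinearMap.snd ℝ ℂ ℂ) (hzi t)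
    rw [map_add, ← ContinuousLinearMap.intervalIntegral_comp_comm _ (hint t)] at h
    simp only [hNa, ContinuousLinearMap.coe_snd'] at h
    rw [h, sub_eq_add_neg, ← intervalIntegral.integral_const_mul, ← intervalIntegral.integral_neg]
    simp [mul_assoc]
  have hv : Continuous fun t => (z t).2 := by fun_prop
  refine ⟨fun t => (z t).1, fun t => (z t).2, hv, by simp [h1], by simp [h2], fun t => ?_, h2⟩
  have h := (intervalIntegral.integral_hasDerivAt_right (hv.intervalIntegrable 0 t)
    (hv.stronglyMeasurableAtFilter _ _) hv.continuousAt).const_add (1 : ℂ)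
  exact h.congr_of_eventuallyEq (Eventually.of_forall h1)

/-- The primitive `∫₀ᵗ ω`, as a complex number. -/
def freqPrimitive (ω : ℝ → ℝ) (t : ℝ) : ℂ := ∫ r in (0 : ℝ)..t, (ω r : ℂ)

lemma IsFrequency.norm_freqPrimitive_sub_le {ω : ℝ → ℝ} (hω : IsFrequency ω) :
    ∃ K, 0 < K ∧ ∀ s t, ‖freqPrimitive ω t - freqPrimitive ω s‖ ≤ K * |t - s| := by
  obtain ⟨K, hK0, hK⟩ := hω.bounded
  refine ⟨K, hK0, fun s t => ?_⟩
  have h1 : ∀ a b, IntervalIntegrable (fun r => (ω r : ℂ)) volume a b := fun a b =>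
    hω.intervalIntegrable_ofReal a b
  rw [freqPrimitive, freqPrimitive, intervalIntegral.integral_interval_sub_left (h1 _ _) (h1 _ _)]
  exact intervalIntegral.norm_integral_le_of_norm_le_const fun x _ => by simpa using hK x

lemma IsFrequency.continuous_freqPrimitive {ω : ℝ → ℝ} (hω : IsFrequency ω) :
    Continuous (freqPrimitive ω) :=
  intervalIntegral.continuous_primitive hω.intervalIntegrable_ofReal 0

lemma freqPrimitive_im (ω : ℝ → ℝ) (t : ℝ) : (freqPrimitive ω t).im = 0 := by
  rw [freqPrimitive, intervalIntegral.integral_ofReal, Complex.ofReal_im]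

lemma conj_freqPrimitive (ω : ℝ → ℝ) (t : ℝ) :
    (starRingEnd ℂ) (freqPrimitive ω t) = freqPrimitive ω t :=
  Complex.conj_eq_iff_im.2 (freqPrimitive_im ω t)

/-- The parameters of a Gaussian `exp (A x² + B x + C)` which solves
`i ∂ₜ ψ = σ (-Δ + ω x²) ψ`. -/
structure IsGaussianFlow (σ : ℝ) (ω : ℝ → ℝ) (A B C : ℝ → ℂ) : Prop where
  re_neg : ∀ t, (A t).re < 0
  hasDerivAt_quadratic : ∀ s, HasDerivAt (fun t => A t + σ * Complex.I * freqPrimitive ω t)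
    (σ * Complex.I * (4 * A s ^ 2)) s
  hasDerivAt_linear : ∀ s, HasDerivAt B (σ * Complex.I * (4 * A s * B s)) s
  hasDerivAt_constant : ∀ s, HasDerivAt C (σ * Complex.I * (B s ^ 2 + 2 * A s)) s

lemma hasDerivAt_conj {f : ℝ → ℂ} {f' : ℂ} {s : ℝ} (h : HasDerivAt f f' s) :
    HasDerivAt (fun t => (starRingEnd ℂ) (f t)) ((starRingEnd ℂ) f') s :=
  Complex.conjCLE.toContinuousLinearMap.hasFDerivAt.comp_hasDerivAt s h

/-- The frequency is real, so conjugation only changes the sign of `i`, that is, the direction of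
time. The conjugate Gaussians are the test functions of the duality argument. -/
lemma IsGaussianFlow.conj {σ : ℝ} {ω : ℝ → ℝ} {A B C : ℝ → ℂ} (h : IsGaussianFlow σ ω A B C) :
    IsGaussianFlow (-σ) ω (fun t => (starRingEnd ℂ) (A t)) (fun t => (starRingEnd ℂ) (B t))
      (fun t => (starRingEnd ℂ) (C t)) where
  re_neg t := by simpa using h.re_neg t
  hasDerivAt_quadratic s := by
    simpa [conj_freqPrimitive, map_ofNat] using (hasDerivAt_conj (h.hasDerivAt_quadratic s))
  hasDerivAt_linear s := by simpa [map_ofNat] using (hasDerivAt_conj (h.hasDerivAt_linear s))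
  hasDerivAt_constant s := by simpa [map_ofNat] using (hasDerivAt_conj (h.hasDerivAt_constant s))

/-- Linearisation of the Riccati equation: `A = (i/4) v/y`, `B = b/y`, and `C` by quadrature. The
free parameter `b` reaches any prescribed value of `B` at time `t`, as `y t ≠ 0`. -/
theorem exists_gaussianFlow {ω : ℝ → ℝ} (hω : IsFrequency ω) :
    ∃ (A : ℝ → ℂ) (B C : ℂ → ℝ → ℂ), (∀ b, IsGaussianFlow 1 ω A (B b) (C b)) ∧
      ∀ t β, ∃ b, B b t = β := by
  obtain ⟨y, v, hvc, hy0, hv0, hy, hv⟩ := exists_oscillator hω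
  have hyc : Continuous y := continuous_iff_continuousAt.2 fun t => (hy t).continuousAt
  set W := freqPrimitive ω with hW
  have hWc : Continuous W := hω.continuous_freqPrimitive
  -- The term `4 W y` cancels the contribution of `ω` to `v'`, so `w' = 4 W v` holds at every time.
  -- Since `W` is real, `conj y · w` and `conj y · v` have the same imaginary part, the Wronskian.
  set w : ℝ → ℂ := fun t => v t + 4 * W t * y t with hw
  have hwd : ∀ s, HasDerivAt w (4 * W s * v s) s := by
    intro s
    have h1 := hasDerivWithinAt_integral_mul_sub hω Set.ordConnected_univ (Set.mem_univ 0)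
      hyc.continuousOn (Set.mem_univ s)
    rw [hasDerivWithinAt_univ] at h1
    have h2 := hasDerivAt_continuousAt_mul (hWc.continuousAt (x := s)) ((hy s).sub_const (y s))
      (sub_self _)
    have h3 := ((h1.const_mul (-4)).add (h2.const_mul 4)).const_add (2 * Complex.I)
    refine (h3.congr_of_eventuallyEq (Eventually.of_forall fun t => ?_)).congr_deriv (by ring)
    simp only [hw, hv t, Pi.add_apply]
    simp only [hW, freqPrimitive]
    ring
  have hwr : ∀ t, ((starRingEnd ℂ) (y t) * v t).im = 2 := by
    have hd : ∀ s, HasDerivAt (fun t => Complex.imCLM ((starRingEnd ℂ) (y t) * w t)) 0 s := by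
      intro s
      have h := Complex.imCLM.hasFDerivAt.comp_hasDerivAt s ((hasDerivAt_conj (hy s)).mul (hwd s))
      refine h.congr_deriv ?_
      have hWi := freqPrimitive_im ω s
      rw [← hW] at hWi
      simp [hw, hWi]
      ring
    have hc := is_const_of_deriv_eq_zero (fun s => (hd s).differentiableAt) (fun s => (hd s).deriv)
    intro t
    have h := hc t 0
    have hWi := freqPrimitive_im ω t
    rw [← hW] at hWi
    have hW0 : W 0 = 0 := by simp [hW, freqPrimitive]
    simp [hw, hWi, hy0, hv0, hW0] at h
    simp
    linarith
  have hyne : ∀ t, y t ≠ 0 := by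
    intro t h
    have := hwr t
    simp [h] at this
  set A : ℝ → ℂ := fun t => Complex.I / 4 * (v t / y t) with hA
  have hAc : Continuous A := by
    simp only [hA]
    exact continuous_const.mul (hvc.div hyc hyne)
  have hBd : ∀ b s, HasDerivAt (fun t => b / y t) (Complex.I * (4 * A s * (b / y s))) s := by
    intro b s
    refine ((hasDerivAt_const s b).div (hy s) (hyne s)).congr_deriv ?_
    have := hyne s
    simp only [hA]
    field_simp
    linear_combination (-(b * v s)) * Complex.I_sq
  have hCcont : ∀ b, Continuous fun r => Complex.I * ((b / y r) ^ 2 + 2 * A r) := fun b =>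
    continuous_const.mul (((continuous_const.div hyc hyne).pow 2).add (continuous_const.mul hAc))
  refine ⟨A, fun b t => b / y t,
    fun b t => ∫ r in (0 : ℝ)..t, Complex.I * ((b / y r) ^ 2 + 2 * A r), fun b => ⟨fun t => ?_,
      fun s => ?_, fun s => ?_, fun s => ?_⟩, fun t β => ⟨β * y t, by
        field_simp [hyne t]⟩⟩
  · have hq : v t / y t = ((starRingEnd ℂ) (y t) * v t) / (Complex.normSq (y t) : ℂ) := by
      rw [Complex.normSq_eq_conj_mul_self]
      have : (starRingEnd ℂ) (y t) ≠ 0 := by simpa using hyne t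
      field_simp
    have him : (v t / y t).im = 2 / Complex.normSq (y t) := by
      rw [hq, Complex.div_ofReal_im, hwr t]
    have hpos : 0 < Complex.normSq (y t) := Complex.normSq_pos.2 (hyne t)
    have : (A t).re = -(v t / y t).im / 4 := by
      simp only [hA]
      generalize v t / y t = q
      simp [Complex.mul_re]
      ring
    rw [this, him]
    have : 0 < 2 / Complex.normSq (y t) := by positivity
    linarith
  · have h := ((hwd s).div (hy s) (hyne s)).const_mul (Complex.I / 4)
    refine (h.congr_of_eventuallyEq (Eventually.of_forall fun t => ?_)).congr_deriv ?_
    · have := hyne t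
      simp only [hA, hw, Pi.div_apply]
      field_simp
      push_cast
      ring
    · have := hyne s
      simp only [hA, hw]
      field_simp
      push_cast
      linear_combination (-(v s) ^ 2) * Complex.I_sq
  · simpa using hBd b s
  · have h := intervalIntegral.integral_hasDerivAt_right ((hCcont b).intervalIntegrable 0 s)
      ((hCcont b).stronglyMeasurableAtFilter _ _) (hCcont b).continuousAt
    simpa using h

/-! ### Schwartz multipliers and the bilinear pairing on `L²` -/

/-- Multiplication by `x` on Schwartz functions. -/
def mulX : 𝓢(ℝ, ℂ) →L[ℂ] 𝓢(ℝ, ℂ) := SchwartzMap.smulLeftCLM ℂ fun x : ℝ => (x : ℂ)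

/-- Multiplication by `x²` on Schwartz functions. -/
def mulXSq : 𝓢(ℝ, ℂ) →L[ℂ] 𝓢(ℝ, ℂ) := SchwartzMap.smulLeftCLM ℂ fun x : ℝ => (x : ℂ) ^ 2

/-- The second derivative on Schwartz functions. -/
def secondDeriv : 𝓢(ℝ, ℂ) →L[ℂ] 𝓢(ℝ, ℂ) :=
  (SchwartzMap.derivCLM ℂ ℂ).comp (SchwartzMap.derivCLM ℂ ℂ)

/-- The inclusion of Schwartz functions in `L²`. -/
def toL2 : 𝓢(ℝ, ℂ) →L[ℂ] L2 := SchwartzMap.toLpCLM ℂ ℂ 2 volume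

/-- The bilinear pairing `∫ f g` on `L²`. -/
def bilin : L2 →L[ℂ] L2 →L[ℂ] ℂ := (ContinuousLinearMap.mul ℂ ℂ).lpPairing volume 2 2

lemma mulX_apply (f : 𝓢(ℝ, ℂ)) (x : ℝ) : mulX f x = x * f x :=
  SchwartzMap.smulLeftCLM_apply_apply (by fun_prop) f x

lemma mulXSq_apply (f : 𝓢(ℝ, ℂ)) (x : ℝ) : mulXSq f x = (x : ℂ) ^ 2 * f x :=
  SchwartzMap.smulLeftCLM_apply_apply (by fun_prop) f x

lemma secondDeriv_apply (f : 𝓢(ℝ, ℂ)) (x : ℝ) : secondDeriv f x = deriv (deriv f) x := by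
  simp only [secondDeriv, ContinuousLinearMap.comp_apply, SchwartzMap.derivCLM_apply]
  congr 1

lemma coeFn_toL2 (f : 𝓢(ℝ, ℂ)) : toL2 f =ᵐ[volume] f := f.coeFn_toLp 2 volume

lemma bilin_apply (f g : L2) : bilin f g = ∫ x, f x * g x := by
  simp [bilin, ContinuousLinearMap.lpPairing_eq_integral]

lemma pairing_eq_bilin (f : 𝓢(ℝ, ℂ)) (ψ : L2) : pairing f ψ = bilin (toL2 f) ψ := by
  rw [bilin_apply, pairing]
  refine integral_congr_ae ?_
  filter_upwards [coeFn_toL2 f] with x hx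
  rw [hx]

lemma harmonicExpr_eq (c : ℝ) (φ : 𝓢(ℝ, ℂ)) :
    harmonicExpr c φ = ⇑(-secondDeriv φ + (c : ℂ) • mulXSq φ) := by
  funext x
  simp [harmonicExpr, secondDeriv_apply, mulXSq_apply]
  ring

lemma pairing_harmonicExpr (c : ℝ) (φ : 𝓢(ℝ, ℂ)) (ψ : L2) :
    pairing (harmonicExpr c φ) ψ
      = -bilin (toL2 (secondDeriv φ)) ψ + c * bilin (toL2 (mulXSq φ)) ψ := by
  rw [harmonicExpr_eq, pairing_eq_bilin]
  simp

lemma bilin_toL2_toL2 (f g : 𝓢(ℝ, ℂ)) : bilin (toL2 f) (toL2 g) = ∫ x, f x * g x := by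
  rw [← pairing_eq_bilin, pairing]
  refine integral_congr_ae ?_
  filter_upwards [coeFn_toL2 g] with x hx
  rw [hx]

lemma bilin_secondDeriv (f g : 𝓢(ℝ, ℂ)) :
    bilin (toL2 f) (toL2 (secondDeriv g)) = bilin (toL2 (secondDeriv f)) (toL2 g) := by
  rw [bilin_toL2_toL2, bilin_toL2_toL2]
  have h1 := SchwartzMap.integral_mul_deriv_eq_neg_deriv_mul f (SchwartzMap.derivCLM ℂ ℂ g)
  have h2 := SchwartzMap.integral_mul_deriv_eq_neg_deriv_mul (SchwartzMap.derivCLM ℂ ℂ f) g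
  simp only [secondDeriv, ContinuousLinearMap.comp_apply]
  simp only [SchwartzMap.derivCLM_apply] at *
  rw [h1, h2, neg_neg]

lemma bilin_mulXSq (f g : 𝓢(ℝ, ℂ)) :
    bilin (toL2 f) (toL2 (mulXSq g)) = bilin (toL2 (mulXSq f)) (toL2 g) := by
  rw [bilin_toL2_toL2, bilin_toL2_toL2]
  congr 1
  funext x
  rw [mulXSq_apply, mulXSq_apply]
  ring

lemma norm_toL2_le {f g : 𝓢(ℝ, ℂ)} {c : ℝ} (h : ∀ x, ‖f x‖ ≤ c * ‖g x‖) :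
    ‖toL2 f‖ ≤ c * ‖toL2 g‖ := by
  refine Lp.norm_le_mul_norm_of_ae_le_mul ?_
  filter_upwards [coeFn_toL2 f, coeFn_toL2 g] with x hf hg
  rw [hf, hg]
  exact h x

/-! ### Gaussians as Schwartz functions -/

/-- The Gaussian `exp (a x² + b x + c)`. -/
def gaussFun (a b c : ℂ) (x : ℝ) : ℂ := Complex.exp (a * (x : ℂ) ^ 2 + b * x + c)

lemma norm_gaussFun (a b c : ℂ) (x : ℝ) :
    ‖gaussFun a b c x‖ = Real.exp (a.re * x ^ 2 + b.re * x + c.re) := by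
  rw [gaussFun, Complex.norm_exp]
  congr 1
  have : (x : ℂ) ^ 2 = ((x ^ 2 : ℝ) : ℂ) := by push_cast; rfl
  simp [this, -Complex.ofReal_pow]

lemma hasDerivAt_gaussFun (a b c : ℂ) (x : ℝ) :
    HasDerivAt (gaussFun a b c) ((2 * a * x + b) * gaussFun a b c x) x := by
  have hx : HasDerivAt (fun x : ℝ => (x : ℂ)) 1 x := (hasDerivAt_id x).ofReal_comp
  have h := ((((hx.pow 2).const_mul a).add (hx.const_mul b)).add_const c).cexp
  refine h.congr_deriv ?_
  simp [gaussFun]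
  ring

lemma exists_pow_mul_norm_gaussFun_le {a : ℂ} (ha : a.re < 0) (b c : ℂ) (k : ℕ) :
    ∃ M, ∀ x : ℝ, |x| ^ k * ‖gaussFun a b c x‖ ≤ M := by
  -- The bound `|x|^k ≤ k! exp |x|` reduces the claim to the maximum of `(1 + |Re b|) |x| + Re a
  -- x²`, found by completing the square.
  refine ⟨k.factorial * Real.exp ((1 + |b.re|) ^ 2 / (4 * -a.re) + c.re), fun x => ?_⟩
  have h1 : |x| ^ k ≤ k.factorial * Real.exp |x| := by
    have := Real.pow_div_factorial_le_exp |x| (abs_nonneg x) k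
    rw [div_le_iff₀ (by positivity)] at this
    linarith
  rw [norm_gaussFun]
  calc |x| ^ k * Real.exp (a.re * x ^ 2 + b.re * x + c.re)
      ≤ k.factorial * Real.exp |x| * Real.exp (a.re * x ^ 2 + b.re * x + c.re) := by gcongr
    _ = k.factorial * Real.exp (|x| + (a.re * x ^ 2 + b.re * x + c.re)) := by
        rw [mul_assoc, ← Real.exp_add]
    _ ≤ _ := by
        refine mul_le_mul_of_nonneg_left (Real.exp_le_exp.2 ?_) (by positivity)
        have h2 : b.re * x ≤ |b.re| * |x| := by rw [← abs_mul]; exact le_abs_self _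
        have h3 : (1 + |b.re|) * |x| + a.re * x ^ 2 ≤ (1 + |b.re|) ^ 2 / (4 * -a.re) := by
          rw [le_div_iff₀ (by linarith), ← sq_abs x]
          nlinarith [sq_nonneg ((1 + |b.re|) + 2 * a.re * |x|)]
        linarith

lemma exists_norm_polynomial_mul_gaussFun_le {a : ℂ} (ha : a.re < 0) (b c : ℂ) (k : ℕ)
    (P : Polynomial ℂ) : ∃ M, ∀ x : ℝ, |x| ^ k * ‖P.eval (x : ℂ) * gaussFun a b c x‖ ≤ M := by
  induction P using Polynomial.induction_on' with
  | add p q hp hq =>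
    obtain ⟨M, hM⟩ := hp
    obtain ⟨M', hM'⟩ := hq
    refine ⟨M + M', fun x => ?_⟩
    rw [Polynomial.eval_add, add_mul]
    calc _ ≤ |x| ^ k * (‖p.eval (x : ℂ) * gaussFun a b c x‖
          + ‖q.eval (x : ℂ) * gaussFun a b c x‖) := by gcongr; exact norm_add_le _ _
      _ ≤ _ := by rw [mul_add]; exact add_le_add (hM x) (hM' x)
  | monomial n z =>
    obtain ⟨M, hM⟩ := exists_pow_mul_norm_gaussFun_le ha b c (k + n)
    refine ⟨‖z‖ * M, fun x => ?_⟩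
    calc _ = ‖z‖ * (|x| ^ (k + n) * ‖gaussFun a b c x‖) := by
          simp [Polynomial.eval_monomial, pow_add]; ring
      _ ≤ _ := by gcongr; exact hM x

lemma exists_iteratedDeriv_gaussFun (a b c : ℂ) (n : ℕ) : ∃ P : Polynomial ℂ,
    iteratedDeriv n (gaussFun a b c) = fun x : ℝ => P.eval (x : ℂ) * gaussFun a b c x := by
  induction n with
  | zero => exact ⟨1, by simp⟩
  | succ n ih =>
    obtain ⟨P, hP⟩ := ih
    refine ⟨P.derivative + P * (Polynomial.C (2 * a) * Polynomial.X + Polynomial.C b), ?_⟩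
    rw [iteratedDeriv_succ, hP]
    funext x
    have h1 : HasDerivAt (fun x : ℝ => P.eval (x : ℂ)) (P.derivative.eval (x : ℂ)) x :=
      (P.hasDerivAt (x : ℂ)).comp_ofReal
    refine (h1.mul (hasDerivAt_gaussFun a b c x)).deriv.trans ?_
    simp
    ring

lemma contDiff_gaussFun (a b c : ℂ) (n : WithTop ℕ∞) : ContDiff ℝ n (gaussFun a b c) := by
  have h : ContDiff ℝ n fun x : ℝ => (x : ℂ) := Complex.ofRealCLM.contDiff
  unfold gaussFun
  exact (((contDiff_const.mul (h.pow 2)).add (contDiff_const.mul h)).add contDiff_const).cexp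

/-- The Gaussian `exp (a x² + b x + c)` as a Schwartz function, for `Re a < 0`. -/
def gauss (a b c : ℂ) : 𝓢(ℝ, ℂ) :=
  if ha : a.re < 0 then
    { toFun := gaussFun a b c
      smooth' := contDiff_gaussFun a b c _
      decay' := fun k n => by
        obtain ⟨P, hP⟩ := exists_iteratedDeriv_gaussFun a b c n
        obtain ⟨M, hM⟩ := exists_norm_polynomial_mul_gaussFun_le ha b c k P
        refine ⟨M, fun x => ?_⟩
        rw [norm_iteratedFDeriv_eq_norm_iteratedDeriv, hP]
        exact hM x }
  else 0

lemma coe_gauss {a : ℂ} (ha : a.re < 0) (b c : ℂ) : ⇑(gauss a b c) = gaussFun a b c := by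
  rw [gauss, dif_pos ha]
  rfl

lemma secondDeriv_gauss {a : ℂ} (ha : a.re < 0) (b c : ℂ) :
    secondDeriv (gauss a b c) = (4 * a ^ 2) • mulXSq (gauss a b c)
      + (4 * a * b) • mulX (gauss a b c) + (b ^ 2 + 2 * a) • gauss a b c := by
  ext x
  simp only [secondDeriv_apply, add_apply, smul_apply, mulXSq_apply,
    mulX_apply, coe_gauss ha, smul_eq_mul]
  have h1 : deriv (gaussFun a b c) = fun x : ℝ => (2 * a * x + b) * gaussFun a b c x :=
    funext fun x => (hasDerivAt_gaussFun a b c x).deriv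
  have hx : HasDerivAt (fun x : ℝ => (x : ℂ)) 1 x := (hasDerivAt_id x).ofReal_comp
  rw [h1]
  refine (((hx.const_mul (2 * a)).add_const b).mul (hasDerivAt_gaussFun a b c x)).deriv.trans ?_
  ring

/-! ### Dependence of Gaussians on their parameters in `L²` -/

/-- A Schwartz function which dominates the Taylor remainders of `gauss` at `(a, b, c)`. -/
def gaussDom (a b c : ℂ) : 𝓢(ℝ, ℂ) :=
  SchwartzMap.smulLeftCLM ℂ (fun x : ℝ => (1 + (x : ℂ) ^ 2) ^ 2)
    (gauss (a + (-a.re / 2 : ℝ)) b (c + (-a.re / 2 : ℝ)))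

/-- The shift by `-a.re / 2` gives up half of the Gaussian decay in exchange for the factor `exp
(-a.re / 2 * (1 + x²))`; the polynomial factor leaves room for a second-order remainder. -/
lemma norm_gaussDom {a : ℂ} (ha : a.re < 0) (b c : ℂ) (x : ℝ) :
    ‖gaussDom a b c x‖
      = (1 + x ^ 2) ^ 2 * (Real.exp (-a.re / 2 * (1 + x ^ 2)) * ‖gaussFun a b c x‖) := by
  have h : (a + (-a.re / 2 : ℝ)).re < 0 := by simp; linarith
  rw [gaussDom, SchwartzMap.smulLeftCLM_apply_apply (by fun_prop), coe_gauss h, norm_smul,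
    norm_gaussFun, norm_gaussFun, ← Real.exp_add]
  have : ‖(1 + (x : ℂ) ^ 2) ^ 2‖ = (1 + x ^ 2) ^ 2 := by
    have e : (1 + (x : ℂ) ^ 2) ^ 2 = (((1 + x ^ 2) ^ 2 : ℝ) : ℂ) := by push_cast; rfl
    rw [e, Complex.norm_real, Real.norm_of_nonneg (by positivity)]
  rw [this]
  congr 2
  simp
  ring

section Taylor

variable {a b c a' b' c' : ℂ} {η : ℝ}

lemma norm_exponent_sub_le (h1 : ‖a' - a‖ ≤ η) (h2 : ‖b' - b‖ ≤ η) (h3 : ‖c' - c‖ ≤ η) (x : ℝ) :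
    ‖(a' - a) * (x : ℂ) ^ 2 + (b' - b) * x + (c' - c)‖ ≤ 2 * η * (1 + x ^ 2) := by
  have hη : 0 ≤ η := (norm_nonneg _).trans h1
  calc _ ≤ ‖(a' - a) * (x : ℂ) ^ 2‖ + ‖(b' - b) * (x : ℂ)‖ + ‖c' - c‖ := norm_add₃_le
    _ = ‖a' - a‖ * |x| ^ 2 + ‖b' - b‖ * |x| + ‖c' - c‖ := by simp
    _ ≤ η * |x| ^ 2 + η * |x| + η := by gcongr
    _ ≤ 2 * η * (1 + x ^ 2) := by
        rw [← sq_abs x]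
        nlinarith [sq_nonneg (|x| - 1), sq_nonneg (|x|), mul_nonneg hη (sq_nonneg (|x| - 1)),
          mul_nonneg hη (sq_nonneg (|x|))]

lemma gaussFun_eq_mul_exp (x : ℝ) : gaussFun a' b' c' x
    = gaussFun a b c x * Complex.exp ((a' - a) * (x : ℂ) ^ 2 + (b' - b) * x + (c' - c)) := by
  rw [gaussFun, gaussFun, ← Complex.exp_add]
  congr 1
  ring

/-- The increment `q` of the exponent is at most `2 η (1 + x²)`, and `η ≤ -a.re / 4` places this
below the decay given up in `gaussDom`. -/
lemma norm_pow_mul_exp_le (hη : η ≤ -a.re / 4) (h1 : ‖a' - a‖ ≤ η)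
    (h2 : ‖b' - b‖ ≤ η) (h3 : ‖c' - c‖ ≤ η) (x : ℝ) (n : ℕ) {q : ℂ}
    (hq : q = (a' - a) * (x : ℂ) ^ 2 + (b' - b) * x + (c' - c)) :
    ‖q‖ ^ n * Real.exp ‖q‖ ≤ (2 * η * (1 + x ^ 2)) ^ n * Real.exp (-a.re / 2 * (1 + x ^ 2)) := by
  have h := norm_exponent_sub_le h1 h2 h3 x
  rw [← hq] at h
  have hη0 : 0 ≤ η := (norm_nonneg _).trans h1
  gcongr
  refine h.trans ?_
  have : 0 ≤ 1 + x ^ 2 := by positivity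
  nlinarith

lemma re_neg_of_norm_sub_le (ha : a.re < 0) (hη : η ≤ -a.re / 4) (h1 : ‖a' - a‖ ≤ η) :
    a'.re < 0 := by
  have := (Complex.re_le_norm (a' - a)).trans h1
  simp at this
  linarith

/-- From `|exp q - 1 - q| ≤ |q|² exp |q|`, where `q` is the increment of the exponent. The error is
quadratic in `η`, so it does not affect time derivatives along Lipschitz parameters. -/
theorem norm_toL2_gauss_taylor_le (ha : a.re < 0) (hη : η ≤ -a.re / 4) (h1 : ‖a' - a‖ ≤ η)
    (h2 : ‖b' - b‖ ≤ η) (h3 : ‖c' - c‖ ≤ η) :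
    ‖toL2 (gauss a' b' c') - toL2 (gauss a b c) - ((a' - a) • toL2 (mulXSq (gauss a b c))
      + (b' - b) • toL2 (mulX (gauss a b c)) + (c' - c) • toL2 (gauss a b c))‖
      ≤ 4 * η ^ 2 * ‖toL2 (gaussDom a b c)‖ := by
  simp only [← map_smul, ← map_add, ← map_sub]
  refine norm_toL2_le fun x => ?_
  simp only [sub_apply, add_apply, smul_apply, mulXSq_apply,
    mulX_apply, coe_gauss ha, coe_gauss (re_neg_of_norm_sub_le ha hη h1), smul_eq_mul,
    norm_gaussDom ha]
  set q : ℂ := (a' - a) * (x : ℂ) ^ 2 + (b' - b) * x + (c' - c) with hq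
  rw [gaussFun_eq_mul_exp (a := a) (b := b) (c := c), ← hq]
  have hb := Complex.norm_exp_sub_sum_le_norm_mul_exp q 2
  simp only [Finset.sum_range_succ, Finset.sum_range_zero] at hb
  norm_num at hb
  have hb2 := hb.trans (norm_pow_mul_exp_le hη h1 h2 h3 x 2 hq)
  calc _ = ‖gaussFun a b c x‖ * ‖Complex.exp q - (1 + q)‖ := by
        rw [← norm_mul]; congr 1; rw [hq]; ring
    _ ≤ ‖gaussFun a b c x‖ * ((2 * η * (1 + x ^ 2)) ^ 2 * Real.exp (-a.re / 2 * (1 + x ^ 2))) := by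
        gcongr
    _ = _ := by ring

theorem norm_toL2_mulXSq_gauss_sub_le (ha : a.re < 0) (hη : η ≤ -a.re / 4) (h1 : ‖a' - a‖ ≤ η)
    (h2 : ‖b' - b‖ ≤ η) (h3 : ‖c' - c‖ ≤ η) :
    ‖toL2 (mulXSq (gauss a' b' c')) - toL2 (mulXSq (gauss a b c))‖
      ≤ 2 * η * ‖toL2 (gaussDom a b c)‖ := by
  simp only [← map_sub]
  have hη0 : 0 ≤ η := (norm_nonneg _).trans h1
  refine norm_toL2_le fun x => ?_
  simp only [sub_apply, mulXSq_apply, coe_gauss ha,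
    coe_gauss (re_neg_of_norm_sub_le ha hη h1), norm_gaussDom ha]
  set q : ℂ := (a' - a) * (x : ℂ) ^ 2 + (b' - b) * x + (c' - c) with hq
  rw [gaussFun_eq_mul_exp (a := a) (b := b) (c := c), ← hq]
  have hb := Complex.norm_exp_sub_sum_le_norm_mul_exp q 1
  simp only [Finset.sum_range_succ, Finset.sum_range_zero] at hb
  norm_num at hb
  have hb2 := hb.trans (by simpa using norm_pow_mul_exp_le hη h1 h2 h3 x 1 hq)
  calc _ = ‖(x : ℂ) ^ 2‖ * (‖gaussFun a b c x‖ * ‖Complex.exp q - 1‖) := by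
        rw [← norm_mul, ← norm_mul]; congr 1; ring
    _ ≤ (1 + x ^ 2) * (‖gaussFun a b c x‖ *
          (2 * η * (1 + x ^ 2) * Real.exp (-a.re / 2 * (1 + x ^ 2)))) := by
        gcongr
        simp
    _ = _ := by ring

end Taylor

/-! ### Strong Gaussian solutions -/

/-- A curve of Schwartz functions which solves `i ∂ₜ f = σ (-Δ + ω x²) f` strongly in `L²`. The
contribution of `ω`, which need not be continuous, enters through its primitive. -/
structure IsStrongCurve (σ : ℝ) (ω : ℝ → ℝ) (f : ℝ → 𝓢(ℝ, ℂ)) : Prop where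
  continuous_mulXSq : Continuous fun t => toL2 (mulXSq (f t))
  hasDerivAt : ∀ s, HasDerivAt
    (fun t => toL2 (f t) + (σ * Complex.I * freqPrimitive ω t) • toL2 (mulXSq (f s)))
    ((σ * Complex.I) • toL2 (secondDeriv (f s))) s

lemma IsFrequency.isBigO_freqPrimitive_sub {ω : ℝ → ℝ} (hω : IsFrequency ω) (s : ℝ) :
    (fun t => freqPrimitive ω t - freqPrimitive ω s) =O[𝓝 s] fun t => t - s := by
  obtain ⟨K, -, hK⟩ := hω.norm_freqPrimitive_sub_le
  exact Asymptotics.isBigO_of_le' _ fun t => by simpa using hK s t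

/-- All parameters move by `O(t - s)`, so the Taylor remainder is `O((t - s)²)`. In the linear part,
the primitive of `ω` turns the increment of `A` into a differentiable one, and the derivatives match
the coefficients in `secondDeriv_gauss`. -/
theorem IsGaussianFlow.isStrongCurve {σ : ℝ} {ω : ℝ → ℝ} (hω : IsFrequency ω) {A B C : ℝ → ℂ}
    (h : IsGaussianFlow σ ω A B C) : IsStrongCurve σ ω fun t => gauss (A t) (B t) (C t) := by
  have hAO : ∀ s, (fun t => A t - A s) =O[𝓝 s] fun t => t - s := by
    intro s
    have h1 := (h.hasDerivAt_quadratic s).isBigO_sub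
    have h2 := (hω.isBigO_freqPrimitive_sub s).const_mul_left (σ * Complex.I)
    refine (h1.sub h2).congr_left fun t => ?_
    ring
  set η : ℝ → ℝ → ℝ := fun s t => ‖A t - A s‖ + ‖B t - B s‖ + ‖C t - C s‖ with hη
  have hηO : ∀ s, η s =O[𝓝 s] fun t => t - s := fun s =>
    ((hAO s).norm_left.add (h.hasDerivAt_linear s).isBigO_sub.norm_left).add
      (h.hasDerivAt_constant s).isBigO_sub.norm_left
  have hts : ∀ s : ℝ, Tendsto (fun t => t - s) (𝓝 s) (𝓝 0) := fun s => by
    have : Continuous fun t : ℝ => t - s := by fun_prop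
    simpa using this.tendsto s
  have hη0 : ∀ s, Tendsto (η s) (𝓝 s) (𝓝 0) := fun s => (hηO s).trans_tendsto (hts s)
  have hev : ∀ s, ∀ᶠ t in 𝓝 s, η s t ≤ -(A s).re / 4 := fun s => by
    have := h.re_neg s
    exact ((hη0 s).eventually (Iio_mem_nhds (by linarith : (0 : ℝ) < -(A s).re / 4))).mono
      fun t ht => le_of_lt ht
  have hA : ∀ s t, ‖A t - A s‖ ≤ η s t := fun s t => by
    simp only [hη]; linarith [norm_nonneg (B t - B s), norm_nonneg (C t - C s)]
  have hB : ∀ s t, ‖B t - B s‖ ≤ η s t := fun s t => by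
    simp only [hη]; linarith [norm_nonneg (A t - A s), norm_nonneg (C t - C s)]
  have hC : ∀ s t, ‖C t - C s‖ ≤ η s t := fun s t => by
    simp only [hη]; linarith [norm_nonneg (A t - A s), norm_nonneg (B t - B s)]
  refine ⟨continuous_iff_continuousAt.2 fun s => ?_, fun s => ?_⟩
  · rw [ContinuousAt, tendsto_iff_norm_sub_tendsto_zero]
    have hz : Tendsto (fun t => 2 * η s t * ‖toL2 (gaussDom (A s) (B s) (C s))‖) (𝓝 s) (𝓝 0) := by
      simpa using ((hη0 s).const_mul 2).mul_const ‖toL2 (gaussDom (A s) (B s) (C s))‖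
    refine squeeze_zero' (Eventually.of_forall fun t => norm_nonneg _) ?_ hz
    filter_upwards [hev s] with t ht
    exact norm_toL2_mulXSq_gauss_sub_le (h.re_neg s) ht (hA s t) (hB s t) (hC s t)
  · set F := toL2 (gauss (A s) (B s) (C s)) with hF
    set XF := toL2 (mulXSq (gauss (A s) (B s) (C s))) with hXF
    set MF := toL2 (mulX (gauss (A s) (B s) (C s))) with hMF
    have hrem : HasDerivAt (fun t => toL2 (gauss (A t) (B t) (C t)) - F
        - ((A t - A s) • XF + (B t - B s) • MF + (C t - C s) • F)) 0 s := by
      rw [hasDerivAt_iff_isLittleO]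
      have hO : (fun t => toL2 (gauss (A t) (B t) (C t)) - F
          - ((A t - A s) • XF + (B t - B s) • MF + (C t - C s) • F)) =O[𝓝 s]
          fun t => (t - s) ^ 2 := by
        refine Asymptotics.IsBigO.trans ?_ ((hηO s).pow 2)
        refine Asymptotics.IsBigO.of_bound (4 * ‖toL2 (gaussDom (A s) (B s) (C s))‖) ?_
        filter_upwards [hev s] with t ht
        refine (norm_toL2_gauss_taylor_le (h.re_neg s) ht (hA s t) (hB s t) (hC s t)).trans_eq ?_
        rw [Real.norm_of_nonneg (by positivity)]
        ring
      have ho : (fun t : ℝ => (t - s) ^ 2) =o[𝓝 s] fun t => t - s := by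
        have := ((Asymptotics.isLittleO_one_iff ℝ).2 (hts s)).mul_isBigO
          (Asymptotics.isBigO_refl (fun t : ℝ => t - s) (𝓝 s))
        refine (this.congr_left fun t => by ring).congr_right fun t => by ring
      refine (hO.trans_isLittleO ho).congr_left fun t => ?_
      simp [hF]
    have h1 := (h.hasDerivAt_quadratic s).smul_const XF
    have h2 := ((h.hasDerivAt_linear s).sub_const (B s)).smul_const MF
    have h3 := ((h.hasDerivAt_constant s).sub_const (C s)).smul_const F
    have h4 := ((((hrem.add h1).add h2).add h3).add_const F).sub_const (A s • XF)
    refine (h4.congr_of_eventuallyEq (Eventually.of_forall fun t => ?_)).congr_deriv ?_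
    · simp only [Pi.add_apply]
      module
    · rw [secondDeriv_gauss (h.re_neg s)]
      simp only [map_add, map_smul]
      rw [← hF, ← hXF, ← hMF]
      module

lemma IsStrongCurve.isBigO_sub {σ : ℝ} {ω : ℝ → ℝ} (hω : IsFrequency ω) {f : ℝ → 𝓢(ℝ, ℂ)}
    (h : IsStrongCurve σ ω f) (s : ℝ) :
    (fun t => toL2 (f t) - toL2 (f s)) =O[𝓝 s] fun t => t - s := by
  have h1 := (h.hasDerivAt s).isBigO_sub
  have h2 : (fun t => (σ * Complex.I * (freqPrimitive ω t - freqPrimitive ω s))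
      • toL2 (mulXSq (f s))) =O[𝓝 s] fun t => t - s := by
    have := ((hω.isBigO_freqPrimitive_sub s).const_mul_left (σ * Complex.I)).smul
      (Asymptotics.isBigO_refl (fun _ : ℝ => toL2 (mulXSq (f s))) (𝓝 s))
    refine this.trans ?_
    refine Asymptotics.IsBigO.of_bound ‖toL2 (mulXSq (f s))‖ (Eventually.of_forall fun t => ?_)
    rw [norm_smul, mul_comm]
  refine (h1.sub h2).congr_left fun t => ?_
  module

lemma IsStrongCurve.continuous {σ : ℝ} {ω : ℝ → ℝ} (hω : IsFrequency ω) {f : ℝ → 𝓢(ℝ, ℂ)}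
    (h : IsStrongCurve σ ω f) : Continuous fun t => toL2 (f t) := by
  refine continuous_iff_continuousAt.2 fun s => ?_
  have hts : Tendsto (fun t => t - s) (𝓝 s) (𝓝 0) := by
    have : Continuous fun t : ℝ => t - s := by fun_prop
    simpa using this.tendsto s
  rw [ContinuousAt, tendsto_iff_norm_sub_tendsto_zero, ← tendsto_zero_iff_norm_tendsto_zero]
  exact (h.isBigO_sub hω s).trans_tendsto hts

/-! ### Weak solutions and their duality with strong ones -/

/-- `IsSolution`, on an arbitrary set of times. -/
structure IsWeakSolutionOn (S : Set ℝ) (ω : ℝ → ℝ) (ψ : ℝ → L2) : Prop where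
  continuousOn : ContinuousOn ψ S
  equation : ∀ φ : 𝓢(ℝ, ℂ), ∀ t ∈ S, pairing φ (ψ t) = pairing φ (ψ 0)
    - Complex.I * ∫ s in (0 : ℝ)..t, pairing (harmonicExpr (ω s) φ) (ψ s)

lemma isSolution_iff {T : ℝ} {ω : ℝ → ℝ} {ψ : ℝ → L2} :
    IsSolution T ω ψ ↔ IsWeakSolutionOn (Set.Icc 0 T) ω ψ :=
  ⟨fun h => ⟨h.1, h.2⟩, fun h => ⟨h.1, h.2⟩⟩

lemma continuousOn_bilin {S : Set ℝ} {F ψ : ℝ → L2} (hF : ContinuousOn F S)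
    (hψ : ContinuousOn ψ S) : ContinuousOn (fun t => bilin (F t) (ψ t)) S :=
  (bilin.continuous.comp_continuousOn hF).clm_apply hψ

lemma integral_pairing_harmonicExpr {ω : ℝ → ℝ} (hω : IsFrequency ω) {ψ : ℝ → L2} {a b : ℝ}
    (hψ : ContinuousOn ψ (Set.uIcc a b)) (φ : 𝓢(ℝ, ℂ)) :
    ∫ s in a..b, pairing (harmonicExpr (ω s) φ) (ψ s)
      = -(∫ s in a..b, bilin (toL2 (secondDeriv φ)) (ψ s))
        + ∫ s in a..b, (ω s : ℂ) * bilin (toL2 (mulXSq φ)) (ψ s) := by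
  simp only [pairing_harmonicExpr]
  rw [intervalIntegral.integral_add, intervalIntegral.integral_neg]
  · exact (continuousOn_bilin continuousOn_const hψ).neg.intervalIntegrable
  · exact hω.intervalIntegrable_mul (continuousOn_bilin continuousOn_const hψ)

lemma eq_of_hasDerivWithinAt_zero {S : Set ℝ} (hS : S.OrdConnected) {G : ℝ → ℂ}
    (h : ∀ s ∈ S, HasDerivWithinAt G 0 S s) {s t : ℝ} (hs : s ∈ S) (ht : t ∈ S) : G t = G s := by
  have := Convex.norm_image_sub_le_of_norm_hasDerivWithin_le (C := 0) h (fun _ _ => by simp)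
    hS.convex hs ht
  rw [zero_mul] at this
  exact sub_eq_zero.1 (norm_le_zero_iff.1 this)

theorem IsStrongCurve.isWeakSolutionOn {ω : ℝ → ℝ} (hω : IsFrequency ω) {f : ℝ → 𝓢(ℝ, ℂ)}
    (h : IsStrongCurve 1 ω f) : IsWeakSolutionOn Set.univ ω fun t => toL2 (f t) := by
  have hc := h.continuous hω
  refine ⟨hc.continuousOn, fun φ t _ => ?_⟩
  rw [integral_pairing_harmonicExpr hω hc.continuousOn, pairing_eq_bilin, pairing_eq_bilin]
  have hd : ∀ s ∈ Set.univ, HasDerivWithinAt (fun t => bilin (toL2 φ) (toL2 (f t))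
      - Complex.I * (∫ s in (0 : ℝ)..t, bilin (toL2 (secondDeriv φ)) (toL2 (f s)))
      + Complex.I * ∫ s in (0 : ℝ)..t, (ω s : ℂ) * bilin (toL2 (mulXSq φ)) (toL2 (f s)))
      0 Set.univ s := by
    intro s hs
    have h1 := ((bilin (toL2 φ)).restrictScalars ℝ).hasFDerivAt.comp_hasDerivAt s (h.hasDerivAt s)
    have h2 := hasDerivWithinAt_integral_of_continuousOn Set.ordConnected_univ (Set.mem_univ 0)
      (continuousOn_bilin (continuousOn_const (c := toL2 (secondDeriv φ))) hc.continuousOn) hs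
    have h3 := hasDerivWithinAt_integral_mul_sub hω Set.ordConnected_univ (Set.mem_univ 0)
      (continuousOn_bilin (continuousOn_const (c := toL2 (mulXSq φ))) hc.continuousOn) hs
    have h4 := (h1.hasDerivWithinAt.sub (h2.const_mul Complex.I)).add (h3.const_mul Complex.I)
    refine (h4.congr_of_mem (fun t _ => ?_) hs).congr_deriv ?_
    · simp only [Pi.add_apply, Pi.sub_apply, Function.comp_apply,
        ContinuousLinearMap.coe_restrictScalars', map_add, map_smul, bilin_mulXSq, freqPrimitive,
        smul_eq_mul]
      push_cast
      ring
    · simp [bilin_secondDeriv]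
  have := eq_of_hasDerivWithinAt_zero Set.ordConnected_univ hd (Set.mem_univ 0) (Set.mem_univ t)
  simp only [intervalIntegral.integral_same, mul_zero, sub_zero, add_zero] at this
  linear_combination this

lemma IsFrequency.sub {u ω : ℝ → ℝ} (hu : IsFrequency u) (hω : IsFrequency ω) :
    IsFrequency fun t => u t - ω t := by
  obtain ⟨K, hK0, hK⟩ := hu.bounded
  obtain ⟨K', hK0', hK'⟩ := hω.bounded
  exact ⟨hu.aemeasurable.sub hω.aemeasurable, K + K', by positivity,
    fun t => (abs_sub _ _).trans (add_le_add (hK t) (hK' t))⟩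

/-- The pairing of a weak solution of frequency `u` with a backward strong solution of
frequency `ω`. -/
theorem IsWeakSolutionOn.pairing_strongCurve {S : Set ℝ} (hS : S.OrdConnected) (h0 : (0 : ℝ) ∈ S)
    {u ω : ℝ → ℝ} (hu : IsFrequency u) (hω : IsFrequency ω) {χ : ℝ → L2}
    (hχ : IsWeakSolutionOn S u χ) {f : ℝ → 𝓢(ℝ, ℂ)} (hf : IsStrongCurve (-1) ω f)
    {t : ℝ} (ht : t ∈ S) :
    pairing (f t) (χ t) = pairing (f 0) (χ 0)
      - Complex.I * ∫ r in (0 : ℝ)..t, ((u r - ω r : ℝ) : ℂ) * bilin (toL2 (mulXSq (f r))) (χ r) := by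
  have hFc := hf.continuous hω
  -- A product rule by hand: `p1` varies `χ`, `p2` varies `f`, and the mixed term `p4` is `o(t - s)`
  -- since `f` moves by `O(t - s)` and `χ` is continuous. The frozen primitives of `u` and `ω` in
  -- `p1` and `p2` cancel against the one in `p3`.
  have hd : ∀ s ∈ S, HasDerivWithinAt (fun t => bilin (toL2 (f t)) (χ t) + Complex.I *
      ∫ r in (0 : ℝ)..t, ((u r - ω r : ℝ) : ℂ) * bilin (toL2 (mulXSq (f r))) (χ r)) 0 S s := by
    intro s hs
    have p1 : HasDerivWithinAt (fun t => bilin (toL2 (f s)) (χ t)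
        + Complex.I * (freqPrimitive u t * bilin (toL2 (mulXSq (f s))) (χ s)))
        (Complex.I * bilin (toL2 (secondDeriv (f s))) (χ s)) S s := by
      have h2 := hasDerivWithinAt_integral_of_continuousOn hS h0
        (continuousOn_bilin (continuousOn_const (c := toL2 (secondDeriv (f s)))) hχ.continuousOn) hs
      have h3 := hasDerivWithinAt_integral_mul_sub hu hS h0
        (continuousOn_bilin (continuousOn_const (c := toL2 (mulXSq (f s)))) hχ.continuousOn) hs
      have h4 := ((h2.const_mul Complex.I).sub (h3.const_mul Complex.I)).const_add
        (bilin (toL2 (f s)) (χ 0))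
      refine (h4.congr_of_mem (fun t ht => ?_) hs).congr_deriv (by simp)
      have he := hχ.equation (f s) t ht
      rw [integral_pairing_harmonicExpr hu (hχ.continuousOn.mono (hS.uIcc_subset h0 ht)),
        pairing_eq_bilin, pairing_eq_bilin] at he
      simp only [Pi.sub_apply, he, freqPrimitive]
      ring
    have p2 : HasDerivWithinAt (fun t => bilin (toL2 (f t)) (χ s)
        - Complex.I * (freqPrimitive ω t * bilin (toL2 (mulXSq (f s))) (χ s)))
        (-(Complex.I * bilin (toL2 (secondDeriv (f s))) (χ s))) S s := by
      have h1 := ((bilin.flip (χ s)).restrictScalars ℝ).hasFDerivAt.comp_hasDerivAt s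
        (hf.hasDerivAt s)
      refine (h1.hasDerivWithinAt.congr_of_mem (fun t _ => ?_) hs).congr_deriv (by simp)
      simp
      ring
    have p3 := (hasDerivWithinAt_integral_mul_sub (hu.sub hω) hS h0
      (continuousOn_bilin hf.continuous_mulXSq.continuousOn hχ.continuousOn) hs).const_mul
        Complex.I
    have p4 : HasDerivWithinAt (fun t => bilin (toL2 (f t) - toL2 (f s)) (χ t - χ s)) 0 S s := by
      rw [hasDerivWithinAt_iff_isLittleO]
      have h1 := (hf.isBigO_sub hω s).mono (nhdsWithin_le_nhds (s := S))
      have h2 : (fun t => χ t - χ s) =o[𝓝[S] s] fun _ => (1 : ℝ) := by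
        rw [Asymptotics.isLittleO_one_iff]
        simpa using (hχ.continuousOn s hs).sub_const (χ s)
      have h3 : (fun t => bilin (toL2 (f t) - toL2 (f s)) (χ t - χ s)) =O[𝓝[S] s]
          fun t => ‖toL2 (f t) - toL2 (f s)‖ * ‖χ t - χ s‖ :=
        Asymptotics.IsBigO.of_bound ‖bilin‖ (Eventually.of_forall fun t => by
          rw [norm_mul, norm_norm, norm_norm, ← mul_assoc]
          exact bilin.le_opNorm₂ _ _)
      have h4 := h3.trans_isLittleO (h1.norm_left.mul_isLittleO h2.norm_left)
      refine (h4.congr_left fun t => ?_).congr_right fun t => ?_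
      · simp
      · simp
    have h5 := (((p1.add p2).add p3).add p4).sub_const (bilin (toL2 (f s)) (χ s))
    refine (h5.congr_of_mem (fun t _ => ?_) hs).congr_deriv (by ring)
    have hi : ∫ r in (0 : ℝ)..t, ((u r - ω r : ℝ) : ℂ)
        = freqPrimitive u t - freqPrimitive ω t := by
      simp only [Complex.ofReal_sub, freqPrimitive]
      exact intervalIntegral.integral_sub (hu.intervalIntegrable_ofReal _ _)
        (hω.intervalIntegrable_ofReal _ _)
    simp only [Pi.add_apply, hi, map_sub, sub_apply]
    ring
  have := eq_of_hasDerivWithinAt_zero hS hd h0 ht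
  simp only [intervalIntegral.integral_same, mul_zero, add_zero] at this
  rw [pairing_eq_bilin, pairing_eq_bilin]
  linear_combination this

/-! ### Totality of the Gaussians -/

/-- A smooth compactly supported test function is the Fourier transform of a Schwartz function, and
the transform can be moved over to `g`. -/
theorem ae_eq_zero_of_fourier_eq_zero {g : ℝ → ℂ} (hg : Integrable g) (h : ∀ ξ, 𝓕 g ξ = 0) :
    ∀ᵐ x, g x = 0 := by
  refine ae_eq_zero_of_integral_contDiff_smul_eq_zero hg.locallyIntegrable fun φ hφ hφc => ?_
  have hc : HasCompactSupport fun x => (φ x : ℂ) := hφc.comp_left (g := fun x : ℝ => (x : ℂ)) rfl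
  have hs : ContDiff ℝ ((⊤ : ℕ∞) : WithTop ℕ∞) fun x => (φ x : ℂ) := Complex.ofRealCLM.contDiff.comp hφ
  set Φ : 𝓢(ℝ, ℂ) := hc.toSchwartzMap hs with hΦ
  have hΦa : ∀ x, Φ x = (φ x : ℂ) := fun x => rfl
  have key : ∫ ξ, (𝓕 (𝓕⁻ Φ)) ξ • g ξ = ∫ x, (𝓕⁻ Φ) x • 𝓕 g x := by
    have := VectorFourier.integral_fourierIntegral_smul_eq_flip (μ := volume) (ν := volume) (L := innerₗ ℝ)
      Real.continuous_fourierChar continuous_inner (𝓕⁻ Φ).integrable hg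
    rwa [flip_innerₗ] at this
  rw [FourierTransform.fourier_fourierInv_eq] at key
  simpa [h, hΦa] using key

lemma gauss_apply {a : ℂ} (ha : a.re < 0) (b c : ℂ) (x : ℝ) :
    gauss a b c x = gaussFun a b c x := by rw [coe_gauss ha]

/-- The Gaussians with a given quadratic term separate the points of `L²`. -/
theorem eq_zero_of_forall_pairing_gauss {a : ℂ} (ha : a.re < 0) {C : ℂ → ℂ} {χ : L2}
    (h : ∀ b, pairing (gauss a b (C b)) χ = 0) : χ = 0 := by
  have hint : Integrable fun x => gaussFun a 0 0 x * χ x := by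
    have h1 : MemLp (gaussFun a 0 0) 2 volume := by
      have := (gauss a 0 0).memLp 2 volume
      rwa [coe_gauss ha] at this
    exact h1.integrable_mul (Lp.memLp χ)
  have hF : ∀ ξ, 𝓕 (fun x => gaussFun a 0 0 x * χ x) ξ = 0 := by
    intro ξ
    -- A purely imaginary `b` turns the linear term into the Fourier character at `ξ`; the factor
    -- `exp (C b)` never vanishes.
    have hb := h (-(2 * Real.pi * ξ : ℝ) * Complex.I)
    set b : ℂ := -(2 * Real.pi * ξ : ℝ) * Complex.I with hb'
    rw [Real.fourier_real_eq_integral_exp_smul]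
    have e : pairing (gauss a b (C b)) χ = Complex.exp (C b) *
        ∫ x : ℝ, Complex.exp (↑(-2 * Real.pi * x * ξ) * Complex.I) • (gaussFun a 0 0 x * χ x) := by
      rw [pairing, ← integral_const_mul]
      congr 1
      funext x
      rw [gauss_apply ha, smul_eq_mul, ← mul_assoc, ← mul_assoc, gaussFun, gaussFun,
        ← Complex.exp_add, ← Complex.exp_add]
      congr 2
      rw [hb']
      push_cast
      ring
    rw [e] at hb
    exact (mul_eq_zero.1 hb).resolve_left (Complex.exp_ne_zero _)
  have hz := ae_eq_zero_of_fourier_eq_zero hint hF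
  rw [Lp.eq_zero_iff_ae_eq_zero]
  filter_upwards [hz] with x hx
  exact (mul_eq_zero.1 hx).resolve_left (Complex.exp_ne_zero _)

lemma inner_toL2_gauss {a : ℂ} (ha : a.re < 0) (b c : ℂ) (ψ : L2) :
    inner ℂ (toL2 (gauss a b c)) ψ
      = pairing (gauss ((starRingEnd ℂ) a) ((starRingEnd ℂ) b) ((starRingEnd ℂ) c)) ψ := by
  rw [L2.inner_def, pairing]
  refine integral_congr_ae ?_
  filter_upwards [coeFn_toL2 (gauss a b c)] with x hx
  have ha' : ((starRingEnd ℂ) a).re < 0 := by simpa using ha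
  rw [hx, gauss_apply ha, gauss_apply ha', RCLike.inner_apply', gaussFun, gaussFun,
    ← Complex.exp_conj]
  simp

/-- A family of Gaussian solutions, together with the family of conjugate solutions, which is
total in `L²` at every time. -/
theorem exists_total_strongCurves {ω : ℝ → ℝ} (hω : IsFrequency ω) :
    ∃ f g : ℂ → ℝ → 𝓢(ℝ, ℂ), (∀ b, IsStrongCurve 1 ω (f b)) ∧ (∀ b, IsStrongCurve (-1) ω (g b)) ∧
      (∀ b t ψ, inner ℂ (toL2 (f b t)) ψ = pairing (g b t) ψ) ∧
      ∀ t, Dense (Submodule.span ℂ (Set.range fun b => toL2 (f b t)) : Set L2) := by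
  obtain ⟨A, B, C, hABC, hB⟩ := exists_gaussianFlow hω
  have hinner := fun b t ψ => inner_toL2_gauss ((hABC 0).re_neg t) (B b t) (C b t) ψ
  refine ⟨fun b t => gauss (A t) (B b t) (C b t), _, fun b => (hABC b).isStrongCurve hω,
    fun b => (hABC b).conj.isStrongCurve hω, hinner, fun t => ?_⟩
  rw [Submodule.dense_iff_topologicalClosure_eq_top, Submodule.topologicalClosure_eq_top_iff,
    Submodule.eq_bot_iff]
  intro χ hχ
  -- `β` selects the member of the family whose linear coefficient at time `t` is prescribed.
  -- Passing from the inner product to the pairing conjugates it, whence the conjugate of `b` below.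
  choose β hβ using fun b => hB t b
  have hz : ∀ b, inner ℂ (toL2 (gauss (A t) (B b t) (C b t))) χ = 0 := fun b =>
    (Submodule.mem_orthogonal _ _).1 hχ _ (Submodule.subset_span ⟨b, rfl⟩)
  refine eq_zero_of_forall_pairing_gauss (a := (starRingEnd ℂ) (A t))
    (C := fun b => (starRingEnd ℂ) (C (β ((starRingEnd ℂ) b)) t))
    (by simpa using (hABC 0).re_neg t) fun b => ?_
  have := hz (β ((starRingEnd ℂ) b))
  rw [hinner, hβ] at this
  simpa using this

/-! ### Isometries and convergence in a Hilbert space -/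

section InnerProductSpace

variable {H : Type*} [NormedAddCommGroup H] [InnerProductSpace ℂ H]

lemma norm_linearCombination_eq_of_inner_eq {ι : Type*} {v w : ι → H}
    (h : ∀ i j, inner ℂ (v i) (v j) = inner ℂ (w i) (w j)) (c : ι →₀ ℂ) :
    ‖Finsupp.linearCombination ℂ v c‖ = ‖Finsupp.linearCombination ℂ w c‖ := by
  have e : inner ℂ (Finsupp.linearCombination ℂ v c) (Finsupp.linearCombination ℂ v c)
      = inner ℂ (Finsupp.linearCombination ℂ w c) (Finsupp.linearCombination ℂ w c) := by
    simp only [Finsupp.linearCombination_apply, Finsupp.sum, sum_inner, inner_sum,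
      inner_smul_left, inner_smul_right, h]
  rw [@norm_eq_sqrt_re_inner ℂ, @norm_eq_sqrt_re_inner ℂ, e]

/-- A total family is mapped to any family with the same Gram matrix by a linear isometry. -/
theorem exists_linearIsometry_of_inner_eq [CompleteSpace H] {ι : Type*} {v w : ι → H}
    (h : ∀ i j, inner ℂ (v i) (v j) = inner ℂ (w i) (w j))
    (hv : Dense (Submodule.span ℂ (Set.range v) : Set H)) :
    ∃ U : H →ₗᵢ[ℂ] H, ∀ i, U (v i) = w i := by
  set e := Finsupp.linearCombination ℂ v with he
  set f := Finsupp.linearCombination ℂ w with hf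
  have hd : DenseRange e := by
    rw [← Finsupp.range_linearCombination] at hv
    exact hv
  have hn : ∀ c, ‖f c‖ = ‖e c‖ := fun c => (norm_linearCombination_eq_of_inner_eq h c).symm
  have happ := fun c => LinearMap.extendOfNorm_eq (f := f) (e := e) hd ⟨1, fun x => by simp [hn x]⟩ c
  refine ⟨⟨(f.extendOfNorm e).toLinearMap, fun x => ?_⟩, fun i => ?_⟩
  · refine hd.induction (P := fun x => ‖f.extendOfNorm e x‖ = ‖x‖) ?_
      (isClosed_eq (by fun_prop) (by fun_prop)) x
    rintro _ ⟨c, rfl⟩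
    rw [happ, hn]
  · have := happ (Finsupp.single i 1)
    simpa [he, hf] using this

/-- The bound on `x n` makes the replacement of `z` by a nearby element of the span uniform in `n`.
-/
lemma tendsto_inner_of_dense_span {ι κ : Type*} {l : Filter κ} {v : ι → H}
    (hv : Dense (Submodule.span ℂ (Set.range v) : Set H)) {x : κ → H} {y : H} {M : ℝ}
    (hM : ∀ n, ‖x n‖ ≤ M) (h : ∀ i, Tendsto (fun n => inner ℂ (v i) (x n)) l (𝓝 (inner ℂ (v i) y)))
    (z : H) : Tendsto (fun n => inner ℂ z (x n)) l (𝓝 (inner ℂ z y)) := by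
  have hspan : ∀ z ∈ Submodule.span ℂ (Set.range v),
      Tendsto (fun n => inner ℂ z (x n)) l (𝓝 (inner ℂ z y)) := by
    intro z hz
    induction hz using Submodule.span_induction with
    | mem z hz => obtain ⟨i, rfl⟩ := hz; exact h i
    | zero => simpa only [inner_zero_left] using tendsto_const_nhds
    | add z z' _ _ h1 h2 => simpa only [inner_add_left] using h1.add h2
    | smul c z _ h1 => simpa only [inner_smul_left] using h1.const_mul _
  rw [Metric.tendsto_nhds]
  intro ε hε
  set K := |M| + ‖y‖ + 1 with hK
  have hK0 : 0 < K := by positivity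
  obtain ⟨z', hz', hzz'⟩ := Metric.mem_closure_iff.1 (hv z) (ε / (4 * K)) (by positivity)
  rw [dist_eq_norm] at hzz'
  filter_upwards [Metric.tendsto_nhds.1 (hspan z' hz') (ε / 2) (by positivity)] with n hn
  rw [dist_eq_norm] at hn ⊢
  have e : inner ℂ z (x n) - inner ℂ z y
      = inner ℂ (z - z') (x n) - inner ℂ (z - z') y + (inner ℂ z' (x n) - inner ℂ z' y) := by
    simp only [inner_sub_left]; ring
  have h1 : ‖inner ℂ (z - z') (x n)‖ ≤ ε / (4 * K) * K := by
    refine (norm_inner_le_norm _ _).trans ?_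
    gcongr
    exact (hM n).trans (by rw [hK]; linarith [le_abs_self M, norm_nonneg y])
  have h2 : ‖inner ℂ (z - z') y‖ ≤ ε / (4 * K) * K := by
    refine (norm_inner_le_norm _ _).trans ?_
    gcongr
    rw [hK]; linarith [abs_nonneg M]
  have h3 : ε / (4 * K) * K = ε / 4 := by field_simp
  rw [e]
  calc _ ≤ ‖inner ℂ (z - z') (x n)‖ + ‖inner ℂ (z - z') y‖
        + ‖inner ℂ z' (x n) - inner ℂ z' y‖ := (norm_add_le _ _).trans (by gcongr; exact norm_sub_le _ _)
    _ < ε := by linarith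

/-- For equal norms, `‖x - y‖² = 2 ‖y‖² - 2 Re ⟪y, x⟫`. -/
lemma tendsto_of_tendsto_inner_of_norm_eq {κ : Type*} {l : Filter κ} {x : κ → H} {y : H}
    (hn : ∀ n, ‖x n‖ = ‖y‖) (h : Tendsto (fun n => inner ℂ y (x n)) l (𝓝 (inner ℂ y y))) :
    Tendsto x l (𝓝 y) := by
  rw [tendsto_iff_norm_sub_tendsto_zero]
  have h1 : Tendsto (fun n => 2 * ‖y‖ ^ 2 - 2 * (inner ℂ y (x n)).re) l (𝓝 0) := by
    have h2 := ((Complex.continuous_re.tendsto _).comp h).const_mul 2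
    have h3 := h2.const_sub (2 * ‖y‖ ^ 2)
    rw [inner_self_eq_norm_sq_to_K] at h3
    simpa [← Complex.ofReal_pow] using h3
  have h4 : ∀ n, ‖x n - y‖ = Real.sqrt (2 * ‖y‖ ^ 2 - 2 * (inner ℂ y (x n)).re) := by
    intro n
    rw [← Real.sqrt_sq (norm_nonneg (x n - y)), @norm_sub_sq ℂ, hn n, inner_re_symm]
    congr 1
    simp only [RCLike.re_to_complex]
    ring
  simp only [h4]
  simpa using h1.sqrt

end InnerProductSpace

/-! ### Uniqueness, propagator and stability -/

/-- Two weak solutions with the same frequency and initial datum coincide. -/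
theorem IsWeakSolutionOn.unique {S : Set ℝ} (hS : S.OrdConnected) (h0 : (0 : ℝ) ∈ S)
    {ω : ℝ → ℝ} (hω : IsFrequency ω) {ψ χ : ℝ → L2} (hψ : IsWeakSolutionOn S ω ψ)
    (hχ : IsWeakSolutionOn S ω χ) (h : ψ 0 = χ 0) : Set.EqOn ψ χ S := by
  intro t ht
  obtain ⟨f, g, -, hg, hfg, hd⟩ := exists_total_strongCurves hω
  refine (hd t).eq_of_inner_right (𝕜 := ℂ) fun v hv => ?_
  induction hv using Submodule.span_induction with
  | mem v hv =>
    obtain ⟨b, rfl⟩ := hv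
    rw [hfg, hfg, hψ.pairing_strongCurve hS h0 hω hω (hg b) ht,
      hχ.pairing_strongCurve hS h0 hω hω (hg b) ht, h]
    simp
  | zero => simp
  | add v w _ _ h1 h2 => rw [inner_add_left, inner_add_left, h1, h2]
  | smul c v _ h1 => rw [inner_smul_left, inner_smul_left, h1]

lemma continuous_isometry_apply_of_dense {Υ : ℝ → L2 →ₗᵢ[ℂ] L2} {K : Set L2} (hK : Dense K)
    (h : ∀ ψ ∈ K, Continuous fun t => Υ t ψ) (ψ : L2) : Continuous fun t => Υ t ψ := by
  refine Metric.continuous_iff.2 fun t ε hε => ?_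
  obtain ⟨φ, hφ, hd⟩ := Metric.mem_closure_iff.1 (hK ψ) (ε / 4) (by positivity)
  obtain ⟨δ, hδ, hc⟩ := Metric.continuous_iff.1 (h φ hφ) t (ε / 2) (by positivity)
  refine ⟨δ, hδ, fun s hs => ?_⟩
  have h1 := hc s hs
  have h2 : dist (Υ s ψ) (Υ s φ) < ε / 4 := by rwa [(Υ s).dist_map]
  have h3 : dist (Υ t φ) (Υ t ψ) < ε / 4 := by rwa [(Υ t).dist_map, dist_comm]
  linarith [dist_triangle4 (Υ s ψ) (Υ s φ) (Υ t φ) (Υ t ψ)]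

/-- The functional `ψ ↦ ∫₀ᵗ u(s) ⟨η, Υ s ψ⟩ ds`. -/
lemma exists_integral_functional {Υ : ℝ → L2 →ₗᵢ[ℂ] L2} (hΥ : ∀ ψ, Continuous fun t => Υ t ψ)
    {u : ℝ → ℝ} (hu : IsFrequency u) (η : L2) (t : ℝ) :
    ∃ J : L2 →L[ℂ] ℂ, ∀ ψ, J ψ = ∫ s in (0 : ℝ)..t, (u s : ℂ) * bilin η (Υ s ψ) := by
  obtain ⟨K, hK0, hK⟩ := hu.bounded
  have hi : ∀ ψ, IntervalIntegrable (fun s => (u s : ℂ) * bilin η (Υ s ψ)) volume 0 t := fun ψ =>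
    hu.intervalIntegrable_mul (continuousOn_bilin continuousOn_const (hΥ ψ).continuousOn)
  refine ⟨LinearMap.mkContinuous
    { toFun := fun ψ => ∫ s in (0 : ℝ)..t, (u s : ℂ) * bilin η (Υ s ψ)
      map_add' := fun ψ χ => by
        rw [← intervalIntegral.integral_add (hi ψ) (hi χ)]
        simp only [map_add, mul_add]
      map_smul' := fun c ψ => by
        rw [RingHom.id_apply, smul_eq_mul, ← intervalIntegral.integral_const_mul]
        congr 1
        funext s
        simp only [map_smul, smul_eq_mul]
        ring } (K * (‖bilin‖ * ‖η‖) * |t|) (fun ψ => ?_), fun ψ => rfl⟩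
  have hb : ∀ s ∈ Set.uIoc 0 t, ‖(u s : ℂ) * bilin η (Υ s ψ)‖ ≤ K * (‖bilin‖ * ‖η‖ * ‖ψ‖) := by
    intro s _
    rw [norm_mul]
    gcongr
    · simpa using hK s
    · simpa using bilin.le_opNorm₂ η (Υ s ψ)
  refine (intervalIntegral.norm_integral_le_of_norm_le_const hb).trans_eq ?_
  rw [sub_zero]
  ring

/-- Existence of the propagator associated with a measurable bounded frequency. -/
theorem exists_propagator {ω : ℝ → ℝ} (hω : IsFrequency ω) :
    ∃ Υ : ℝ → L2 →ₗᵢ[ℂ] L2, (∀ ψ, Υ 0 ψ = ψ) ∧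
      ∀ ψ, IsWeakSolutionOn Set.univ ω fun t => Υ t ψ := by
  obtain ⟨f, g, hf, hg, hfg, hd⟩ := exists_total_strongCurves hω
  have hw := fun b => (hf b).isWeakSolutionOn hω
  -- Each inner product is the pairing of a weak solution with a backward one of the same frequency,
  -- hence constant in time.
  have hgram : ∀ t b b', inner ℂ (toL2 (f b 0)) (toL2 (f b' 0))
      = inner ℂ (toL2 (f b t)) (toL2 (f b' t)) := by
    intro t b b'
    rw [hfg, hfg, (hw b').pairing_strongCurve Set.ordConnected_univ (Set.mem_univ _) hω hω (hg b)
      (Set.mem_univ t)]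
    simp
  choose Υ hΥ using fun t => exists_linearIsometry_of_inner_eq (hgram t) (hd 0)
  have hΥ0 : ∀ ψ, Υ 0 ψ = ψ := by
    have : (Υ 0).toContinuousLinearMap = ContinuousLinearMap.id ℂ L2 := by
      refine ContinuousLinearMap.ext_on (hd 0) ?_
      rintro _ ⟨b, rfl⟩
      exact hΥ 0 b
    exact fun ψ => congrArg (fun L : L2 →L[ℂ] L2 => L ψ) this
  have hcont : ∀ ψ, Continuous fun t => Υ t ψ := by
    refine continuous_isometry_apply_of_dense (hd 0) fun ψ hψ => ?_
    induction hψ using Submodule.span_induction with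
    | mem ψ hψ =>
      obtain ⟨b, rfl⟩ := hψ
      simp only [hΥ]
      exact (hf b).continuous hω
    | zero => simpa using continuous_const
    | add ψ χ _ _ h1 h2 => simp only [map_add]; exact h1.add h2
    | smul c ψ _ h1 => simp only [map_smul]; exact h1.const_smul c
  refine ⟨Υ, hΥ0, fun ψ => ⟨(hcont ψ).continuousOn, fun φ t _ => ?_⟩⟩
  obtain ⟨J, hJ⟩ := exists_integral_functional hcont (IsFrequency.const 1)
    (toL2 (secondDeriv φ)) t
  obtain ⟨J', hJ'⟩ := exists_integral_functional hcont hω (toL2 (mulXSq φ)) t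
  -- For fixed `φ` and `t` the weak equation equates two continuous linear functionals of the
  -- initial datum, so it suffices to check it on the Gaussians.
  have key : (bilin (toL2 φ)).comp (Υ t).toContinuousLinearMap
      = bilin (toL2 φ) + Complex.I • J - Complex.I • J' := by
    refine ContinuousLinearMap.ext_on (hd 0) ?_
    rintro _ ⟨b, rfl⟩
    have h := (hw b).equation φ t (Set.mem_univ t)
    rw [integral_pairing_harmonicExpr hω ((hf b).continuous hω).continuousOn, pairing_eq_bilin,
      pairing_eq_bilin] at h
    simp only [ContinuousLinearMap.comp_apply, LinearIsometry.coe_toContinuousLinearMap, hΥ,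
      sub_apply, add_apply, smul_apply, hJ, hJ', smul_eq_mul, Complex.ofReal_one, one_mul, h]
    ring
  have h := congrArg (fun L : L2 →L[ℂ] ℂ => L ψ) key
  simp only [ContinuousLinearMap.comp_apply, LinearIsometry.coe_toContinuousLinearMap,
    sub_apply, add_apply, smul_apply, hJ, hJ', smul_eq_mul, Complex.ofReal_one, one_mul] at h
  rw [integral_pairing_harmonicExpr hω (hcont ψ).continuousOn, pairing_eq_bilin,
    pairing_eq_bilin, h, hΥ0]
  ring

lemma IsWeakSolutionOn.mono {S S' : Set ℝ} (hSS' : S' ⊆ S) {ω : ℝ → ℝ} {ψ : ℝ → L2}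
    (h : IsWeakSolutionOn S ω ψ) : IsWeakSolutionOn S' ω ψ :=
  ⟨h.continuousOn.mono hSS', fun φ t ht => h.equation φ t (hSS' ht)⟩

/-- By uniqueness the solution is an orbit of the isometric propagator. -/
lemma IsWeakSolutionOn.norm_eq {S : Set ℝ} (hS : S.OrdConnected) (h0 : (0 : ℝ) ∈ S)
    {ω : ℝ → ℝ} (hω : IsFrequency ω) {ψ : ℝ → L2} (hψ : IsWeakSolutionOn S ω ψ) {t : ℝ}
    (ht : t ∈ S) : ‖ψ t‖ = ‖ψ 0‖ := by
  obtain ⟨Υ, hΥ0, hΥ⟩ := exists_propagator hω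
  rw [hψ.unique hS h0 hω ((hΥ (ψ 0)).mono (Set.subset_univ S)) (hΥ0 _).symm ht]
  exact (Υ t).norm_map _

/-- Weak solutions depend continuously on the frequency, for the `L¹` topology. -/
theorem IsWeakSolutionOn.tendsto {T : ℝ} {u : ℕ → ℝ → ℝ} {ω : ℝ → ℝ}
    (hu : ∀ n, IsFrequency (u n)) (hω : IsFrequency ω)
    (hlim : Tendsto (fun n => ∫ s in (0 : ℝ)..T, |u n s - ω s|) atTop (𝓝 0))
    {χ : ℕ → ℝ → L2} {ψ : ℝ → L2} (hχ : ∀ n, IsWeakSolutionOn (Set.Icc 0 T) (u n) (χ n))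
    (hψ : IsWeakSolutionOn (Set.Icc 0 T) ω ψ) (h0 : ∀ n, χ n 0 = ψ 0) {t : ℝ}
    (ht : t ∈ Set.Icc 0 T) : Tendsto (fun n => χ n t) atTop (𝓝 (ψ t)) := by
  have hT0 : (0 : ℝ) ∈ Set.Icc 0 T := ⟨le_rfl, ht.1.trans ht.2⟩
  have hψn := fun {t} (ht : t ∈ Set.Icc 0 T) => hψ.norm_eq Set.ordConnected_Icc hT0 hω ht
  have hχn := fun n {t} (ht : t ∈ Set.Icc 0 T) =>
    (hχ n).norm_eq Set.ordConnected_Icc hT0 (hu n) ht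
  obtain ⟨f, g, hf, hg, hfg, hd⟩ := exists_total_strongCurves hω
  -- All norms equal `‖ψ 0‖`, so convergence against the Gaussians of frequency `ω` is enough. What
  -- remains is the integral of `(u n - ω) ∫ x² g χ n`, controlled by the `L¹` distance.
  refine tendsto_of_tendsto_inner_of_norm_eq
    (fun n => by rw [hχn n ht, h0, hψn ht])
    (tendsto_inner_of_dense_span (M := ‖ψ 0‖) (hd t)
      (fun n => by rw [hχn n ht, h0]) (fun b => ?_) (ψ t))
  simp only [hfg]
  rw [hψ.pairing_strongCurve Set.ordConnected_Icc hT0 hω hω (hg b) ht]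
  simp only [fun n => (hχ n).pairing_strongCurve Set.ordConnected_Icc hT0 (hu n) hω (hg b) ht, h0]
  refine Tendsto.const_sub _ ?_
  simp only [sub_self, Complex.ofReal_zero, zero_mul, intervalIntegral.integral_zero]
  refine Tendsto.const_mul _ ?_
  obtain ⟨M, hM⟩ := isCompact_Icc.exists_bound_of_continuousOn (s := Set.Icc 0 T)
    ((hg b).continuous_mulXSq.continuousOn)
  refine squeeze_zero_norm (fun n => ?_)
    (by simpa using hlim.mul_const (‖bilin‖ * M * ‖ψ 0‖))
  have hint : IntervalIntegrable (fun s => |u n s - ω s| * (‖bilin‖ * M * ‖ψ 0‖)) volume 0 T :=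
    (((hu n).sub hω).intervalIntegrable 0 T).norm.mul_const _
  have hM0 : 0 ≤ M := (norm_nonneg _).trans (hM 0 hT0)
  calc _ ≤ ∫ s in (0 : ℝ)..t, |u n s - ω s| * (‖bilin‖ * M * ‖ψ 0‖) := by
        refine intervalIntegral.norm_integral_le_of_norm_le ht.1
          (Eventually.of_forall fun s hs => ?_) (hint.mono_set ?_)
        · have hsT : s ∈ Set.Icc 0 T := ⟨hs.1.le, hs.2.trans ht.2⟩
          rw [norm_mul, Complex.norm_real, Real.norm_eq_abs]
          gcongr
          refine (bilin.le_opNorm₂ _ _).trans ?_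
          rw [hχn n hsT, h0]
          gcongr
          exact hM s hsT
        · rw [Set.uIcc_of_le ht.1, Set.uIcc_of_le hT0.2]
          exact Set.Icc_subset_Icc_right ht.2
    _ ≤ ∫ s in (0 : ℝ)..T, |u n s - ω s| * (‖bilin‖ * M * ‖ψ 0‖) := by
        refine intervalIntegral.integral_mono_interval le_rfl ht.1 ht.2 ?_ hint
        exact Eventually.of_forall fun s => by
          simp only [Pi.zero_apply]
          positivity
    _ = _ := by rw [intervalIntegral.integral_mul_const]

/-! ### Constant frequencies and their unitary groups -/

lemma IsWeakSolutionOn.congr_ae {S : Set ℝ} (hS : S.OrdConnected) (h0 : (0 : ℝ) ∈ S)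
    {ω ω' : ℝ → ℝ} {ψ : ℝ → L2} (h : IsWeakSolutionOn S ω ψ) (hω : ∀ᵐ s, s ∈ S → ω s = ω' s) :
    IsWeakSolutionOn S ω' ψ := by
  refine ⟨h.continuousOn, fun φ t ht => ?_⟩
  rw [h.equation φ t ht]
  congr 2
  refine intervalIntegral.integral_congr_ae ?_
  filter_upwards [hω] with s hs hst
  rw [hs (hS.uIcc_subset h0 ht (Set.uIoc_subset_uIcc hst))]

lemma intervalIntegrable_pairing_harmonicExpr {ω : ℝ → ℝ} (hω : IsFrequency ω) {ψ : ℝ → L2}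
    {a b : ℝ} (hψ : ContinuousOn ψ (Set.uIcc a b)) (φ : 𝓢(ℝ, ℂ)) :
    IntervalIntegrable (fun s => pairing (harmonicExpr (ω s) φ) (ψ s)) volume a b := by
  simp only [pairing_harmonicExpr]
  exact (continuousOn_bilin continuousOn_const hψ).neg.intervalIntegrable.add
    (hω.intervalIntegrable_mul (continuousOn_bilin continuousOn_const hψ))

lemma IsWeakSolutionOn.shift {S : Set ℝ} (hS : S.OrdConnected) (h0 : (0 : ℝ) ∈ S)
    {ω : ℝ → ℝ} (hω : IsFrequency ω) {ψ : ℝ → L2} (h : IsWeakSolutionOn S ω ψ) {a : ℝ}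
    (ha : a ∈ S) :
    IsWeakSolutionOn ((fun s => a + s) ⁻¹' S) (fun s => ω (a + s)) fun s => ψ (a + s) := by
  refine ⟨h.continuousOn.comp (by fun_prop) fun s hs => hs, fun φ t ht => ?_⟩
  have h1 := h.equation φ (a + t) ht
  have h2 := h.equation φ a ha
  have h3 := intervalIntegral.integral_add_adjacent_intervals
    (intervalIntegrable_pairing_harmonicExpr hω (h.continuousOn.mono (hS.uIcc_subset h0 ha)) φ)
    (intervalIntegrable_pairing_harmonicExpr hω (h.continuousOn.mono (hS.uIcc_subset ha ht)) φ)
  have h4 := intervalIntegral.integral_comp_add_left (a := 0) (b := t)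
    (fun s => pairing (harmonicExpr (ω s) φ) (ψ s)) a
  rw [add_zero] at h4
  simp only [add_zero]
  rw [h4]
  linear_combination h1 - h2 + Complex.I * h3

lemma hasDerivAt_integral_zero {E : Type*} [NormedAddCommGroup E] [NormedSpace ℝ E]
    [CompleteSpace E] {F : ℝ → E} (hF : Continuous F) :
    HasDerivAt (fun t => ∫ s in (0 : ℝ)..t, F s) (F 0) 0 :=
  intervalIntegral.integral_hasDerivAt_right (hF.intervalIntegrable 0 0)
    (hF.stronglyMeasurableAtFilter _ _) hF.continuousAt

lemma exists_pairing_harmonicExpr_eq (c : ℝ) (φ : 𝓢(ℝ, ℂ)) :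
    ∃ η : L2, ∀ χ, pairing (harmonicExpr c φ) χ = bilin η χ :=
  ⟨_, fun χ => by rw [harmonicExpr_eq, pairing_eq_bilin]⟩

lemma bilin_sub_smul_integral {F : ℝ → L2} (hF : Continuous F) (η ψ : L2) (t : ℝ) :
    bilin η (ψ - Complex.I • ∫ s in (0 : ℝ)..t, F s)
      = bilin η ψ - Complex.I * ∫ s in (0 : ℝ)..t, bilin η (F s) := by
  rw [map_sub, map_smul, ← ContinuousLinearMap.intervalIntegral_comp_comm _
    (hF.intervalIntegrable 0 t), smul_eq_mul]

/-- Weak solutions which start in the domain of the harmonic oscillator are differentiable. -/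
theorem IsHarmonicImage.hasDerivAt {c : ℝ} {ψ g : L2} (h : IsHarmonicImage c ψ g) {χ ξ : ℝ → L2}
    (hχ : IsWeakSolutionOn Set.univ (fun _ => c) χ) (hχ0 : χ 0 = ψ)
    (hξ : IsWeakSolutionOn Set.univ (fun _ => c) ξ) (hξ0 : ξ 0 = g) :
    HasDerivAt χ (-(Complex.I • g)) 0 := by
  have hc : Continuous ξ := continuousOn_univ.1 hξ.continuousOn
  -- This curve has initial value `ψ`, and the equation of `ξ` shows that its image under `-Δ + c
  -- x²` at time `s` is `ξ s`. It is therefore a weak solution, equal to `χ`, with derivative `-i ξ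
  -- 0` at `0`.
  have hw : IsWeakSolutionOn Set.univ (fun _ => c)
      fun t => ψ - Complex.I • ∫ s in (0 : ℝ)..t, ξ s := by
    have hp : Continuous fun t => ∫ s in (0 : ℝ)..t, ξ s :=
      intervalIntegral.continuous_primitive (fun a b => hc.intervalIntegrable a b) 0
    have hp' : Continuous fun t => ψ - Complex.I • ∫ s in (0 : ℝ)..t, ξ s :=
      continuous_const.sub (hp.const_smul Complex.I)
    refine ⟨hp'.continuousOn, fun φ t _ => ?_⟩
    obtain ⟨η, hη⟩ := exists_pairing_harmonicExpr_eq c φ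
    have hs : ∀ s : ℝ, pairing (harmonicExpr c φ) (ψ - Complex.I • ∫ r in (0 : ℝ)..s, ξ r)
        = bilin (toL2 φ) (ξ s) := by
      intro s
      have h1 := hξ.equation φ s (Set.mem_univ s)
      rw [← pairing_eq_bilin, h1, hξ0, ← h φ]
      simp only [hη]
      exact bilin_sub_smul_integral hc η ψ s
    simp only [hs]
    rw [pairing_eq_bilin, pairing_eq_bilin, bilin_sub_smul_integral hc]
    simp
  have heq := hw.unique Set.ordConnected_univ (Set.mem_univ 0) (IsFrequency.const c) hχ
    (by simp [hχ0])
  have hd := ((hasDerivAt_integral_zero hc).const_smul Complex.I).const_sub ψ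
  rw [hξ0] at hd
  exact hd.congr_of_eventuallyEq (Eventually.of_forall fun t => (heq (Set.mem_univ t)).symm)

/-- Both sides are read off by differentiating at time `0` the weak equation tested on `φ`. -/
theorem IsWeakSolutionOn.isHarmonicImage {c : ℝ} {g : L2} {χ : ℝ → L2}
    (hχ : IsWeakSolutionOn Set.univ (fun _ => c) χ)
    (h : HasDerivAt χ (-(Complex.I • g)) 0) : IsHarmonicImage c (χ 0) g := by
  intro φ
  have hc : Continuous χ := continuousOn_univ.1 hχ.continuousOn
  obtain ⟨η, hη⟩ := exists_pairing_harmonicExpr_eq c φ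
  have h1 := ((bilin (toL2 φ)).restrictScalars ℝ).hasFDerivAt.comp_hasDerivAt 0 h
  have h2 := ((hasDerivAt_integral_zero ((bilin η).continuous.comp hc)).const_mul
    Complex.I).const_sub (pairing φ (χ 0))
  have h3 := h1.unique (h2.congr_of_eventuallyEq (Eventually.of_forall fun t => by
    have := hχ.equation φ t (Set.mem_univ t)
    simp only [hη] at this
    rw [pairing_eq_bilin φ (χ t)] at this
    exact this))
  simp only [ContinuousLinearMap.coe_restrictScalars', map_neg, map_smul, smul_eq_mul,
    neg_inj, Function.comp_apply] at h3
  rw [pairing_eq_bilin, hη]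
  exact (mul_left_cancel₀ Complex.I_ne_zero h3).symm

/-- The unitary group generated by `-i (-Δ + c x²)`. -/
theorem exists_harmonicGroup (c : ℝ) :
    ∃ U : ℝ → L2 ≃ₗᵢ[ℂ] L2, IsHarmonicGroup c U ∧
      ∀ ψ, IsWeakSolutionOn Set.univ (fun _ => c) fun t => U t ψ := by
  have hc := IsFrequency.const c
  obtain ⟨Υ, hΥ0, hΥ⟩ := exists_propagator hc
  have hadd : ∀ s t ψ, Υ (s + t) ψ = Υ s (Υ t ψ) := by
    intro s t ψ
    have h := (hΥ ψ).shift Set.ordConnected_univ (Set.mem_univ 0) hc (Set.mem_univ t)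
    rw [Set.preimage_univ] at h
    have := h.unique Set.ordConnected_univ (Set.mem_univ 0) hc (hΥ (Υ t ψ)) (by simp [hΥ0])
      (Set.mem_univ s)
    rwa [add_comm s t]
  -- The propagator runs over negative times too, so the group law inverts it.
  have hsurj : ∀ t, Function.Surjective (Υ t) := fun t ψ =>
    ⟨Υ (-t) ψ, by rw [← hadd, add_neg_cancel, hΥ0]⟩
  refine ⟨fun t => LinearIsometryEquiv.ofSurjective (Υ t) (hsurj t), ⟨hadd,
    fun ψ => continuousOn_univ.1 (hΥ ψ).continuousOn, fun ψ g => ⟨fun h => ?_, fun h => ?_⟩⟩, hΥ⟩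
  · exact h.hasDerivAt (hΥ ψ) (hΥ0 ψ) (hΥ g) (hΥ0 g)
  · have := (hΥ ψ).isHarmonicImage h
    rwa [hΥ0] at this

/-! ### Parity -/

/-- The reflection `x ↦ -x` on `L²`. -/
def reflect : L2 →ₗᵢ[ℂ] L2 :=
  Lp.compMeasurePreservingₗᵢ ℂ (fun x : ℝ => -x) (Measure.measurePreserving_neg volume)

lemma coeFn_reflect (ψ : L2) : reflect ψ =ᵐ[volume] fun x => ψ (-x) :=
  Lp.coeFn_compMeasurePreserving ψ (Measure.measurePreserving_neg volume)

lemma isEven_iff_reflect_eq {ψ : L2} : IsEven ψ ↔ reflect ψ = ψ := by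
  rw [Lp.ext_iff]
  constructor
  · intro h
    filter_upwards [h, coeFn_reflect ψ] with x h1 h2
    rw [h2, h1]
  · intro h
    filter_upwards [h, coeFn_reflect ψ] with x h1 h2
    rw [← h1, h2]

lemma pairing_reflect (f : ℝ → ℂ) (ψ : L2) :
    pairing f (reflect ψ) = pairing (fun x => f (-x)) ψ := by
  rw [pairing, pairing, ← integral_neg_eq_self]
  refine integral_congr_ae ?_
  have h := (Measure.measurePreserving_neg (volume : Measure ℝ)).quasiMeasurePreserving.ae
    (coeFn_reflect ψ)
  filter_upwards [h] with x hx
  rw [hx, neg_neg]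

/-- The reflection `x ↦ -x` on Schwartz functions. -/
def reflectSchwartz : 𝓢(ℝ, ℂ) →L[ℂ] 𝓢(ℝ, ℂ) :=
  SchwartzMap.compCLMOfContinuousLinearEquiv ℂ (ContinuousLinearEquiv.neg ℝ)

lemma coe_reflectSchwartz (φ : 𝓢(ℝ, ℂ)) : ⇑(reflectSchwartz φ) = fun x => φ (-x) := rfl

lemma harmonicExpr_reflectSchwartz (c : ℝ) (φ : 𝓢(ℝ, ℂ)) :
    harmonicExpr c (reflectSchwartz φ) = fun x => harmonicExpr c φ (-x) := by
  have h1 : deriv (fun x => φ (-x)) = fun x => -deriv φ (-x) := funext fun x => deriv_comp_neg _ _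
  funext x
  simp only [harmonicExpr, coe_reflectSchwartz, h1, deriv.fun_neg, deriv_comp_neg]
  push_cast
  ring

/-- The operator `-Δ + ω x²` commutes with the reflection. Together with uniqueness this propagates
evenness. -/
lemma IsWeakSolutionOn.reflect {S : Set ℝ} {ω : ℝ → ℝ} {ψ : ℝ → L2}
    (h : IsWeakSolutionOn S ω ψ) : IsWeakSolutionOn S ω fun t => HarmonicTrap.reflect (ψ t) := by
  refine ⟨HarmonicTrap.reflect.continuous.comp_continuousOn h.continuousOn, fun φ t ht => ?_⟩
  have := h.equation (reflectSchwartz φ) t ht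
  simp only [pairing_reflect]
  simpa only [harmonicExpr_reflectSchwartz, coe_reflectSchwartz] using this

/-! ### Functions of bounded variation and their step approximations -/

section Approximation

variable {T : ℝ} {ω : ℝ → ℝ}

lemma BoundedVariationOn.abs_sub_le {s : Set ℝ} {u : ℝ → ℝ} (h : BoundedVariationOn u s) {x y : ℝ}
    (hx : x ∈ s) (hy : y ∈ s) : |u x - u y| ≤ (eVariationOn u s).toReal := by
  rw [← Real.dist_eq]
  exact h.dist_le hx hy

/-- A function of bounded variation is a difference of monotone functions, hence measurable, and
stays within its variation of `ω 0`. Extension by zero gives a frequency for all times. -/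
lemma isFrequency_indicator (h : BoundedVariationOn ω (Set.Icc 0 T)) :
    IsFrequency ((Set.Icc 0 T).indicator ω) := by
  obtain ⟨p, q, hp, hq, hpq⟩ := h.locallyBoundedVariationOn.exists_monotoneOn_sub_monotoneOn
  refine ⟨?_, |ω 0| + (eVariationOn ω (Set.Icc 0 T)).toReal + 1, by positivity, fun t => ?_⟩
  · rw [aemeasurable_indicator_iff measurableSet_Icc, hpq]
    exact (aemeasurable_restrict_of_monotoneOn measurableSet_Icc hp).sub
      (aemeasurable_restrict_of_monotoneOn measurableSet_Icc hq)
  · by_cases ht : t ∈ Set.Icc 0 T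
    · rw [Set.indicator_of_mem ht]
      have h1 := BoundedVariationOn.abs_sub_le h ht ⟨le_rfl, ht.1.trans ht.2⟩
      have h2 := abs_sub_abs_le_abs_sub (ω t) (ω 0)
      linarith
    · rw [Set.indicator_of_notMem ht, abs_zero]
      positivity

/-- The largest point of the subdivision of `[0,T]` into `n + 1` intervals which is at most `t`. -/
def gridFloor (T : ℝ) (n : ℕ) (t : ℝ) : ℝ := T * ⌊t * (n + 1) / T⌋₊ / (n + 1)

lemma gridFloor_monotone (hT : 0 < T) (n : ℕ) : Monotone (gridFloor T n) := by
  intro s t hst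
  unfold gridFloor
  gcongr

lemma gridFloor_le (hT : 0 < T) (n : ℕ) {t : ℝ} (ht : 0 ≤ t) : gridFloor T n t ≤ t := by
  have h := Nat.floor_le (a := t * (n + 1) / T) (by positivity)
  rw [le_div_iff₀ hT] at h
  rw [gridFloor, div_le_iff₀ (by positivity)]
  linarith

lemma lt_gridFloor_add (hT : 0 < T) (n : ℕ) (t : ℝ) : t < gridFloor T n t + T / (n + 1) := by
  have h := Nat.lt_floor_add_one (t * (n + 1) / T)
  rw [div_lt_iff₀ hT] at h
  rw [gridFloor, ← add_div, lt_div_iff₀ (by positivity)]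
  linarith

lemma gridFloor_mem (hT : 0 < T) (n : ℕ) {t : ℝ} (ht : t ∈ Set.Icc 0 T) :
    gridFloor T n t ∈ Set.Icc 0 T :=
  ⟨by unfold gridFloor; positivity, (gridFloor_le hT n ht.1).trans ht.2⟩

lemma tendsto_gridFloor (hT : 0 < T) {t : ℝ} (ht : 0 ≤ t) :
    Tendsto (fun n => gridFloor T n t) atTop (𝓝 t) := by
  have h : Tendsto (fun n : ℕ => t - T / ((n : ℝ) + 1)) atTop (𝓝 t) := by
    have := (tendsto_one_div_add_atTop_nhds_zero_nat (𝕜 := ℝ)).const_mul T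
    simpa [div_eq_mul_inv] using this.const_sub t
  refine tendsto_of_tendsto_of_tendsto_of_le_of_le h tendsto_const_nhds
    (fun n => ?_) fun n => gridFloor_le hT n ht
  have := lt_gridFloor_add hT n t
  simp only
  linarith

lemma isPiecewiseConstant_comp_gridFloor (hT : 0 < T) (n : ℕ) :
    IsPiecewiseConstant T fun t => ω (gridFloor T n t) := by
  refine ⟨n + 1, fun k => T * k / (n + 1), fun k => ω (T * k / (n + 1)), by simp, ?_, fun k _ => ?_,
    fun k _ t ht => ?_⟩
  · push_cast
    field_simp
  · push_cast
    gcongr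
    linarith
  · have h1 := ht.1
    have h2 := ht.2
    rw [div_lt_iff₀ (by positivity)] at h1
    rw [lt_div_iff₀ (by positivity)] at h2
    have : ⌊t * (n + 1) / T⌋₊ = k := by
      have h3 : 0 < t * (n + 1) := lt_of_le_of_lt (by positivity) h1
      push_cast at h2
      rw [Nat.floor_eq_iff (by positivity), le_div_iff₀ hT, div_lt_iff₀ hT]
      constructor <;> linarith
    simp only [gridFloor, this]

/-- Composition with a monotone map of `[0, T]` into itself does not increase the variation and
keeps the lower bound. Convergence holds wherever `ω` is continuous within `[0, T]`, that is, off a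
countable set. -/
theorem exists_isApproximation (hT : 0 < T) {α : ℝ} (hω : ∀ t ∈ Set.Icc 0 T, α < ω t)
    (h : BoundedVariationOn ω (Set.Icc 0 T)) : ∃ u, IsApproximation T α ω u := by
  refine ⟨fun n t => ω (gridFloor T n t), fun n => isPiecewiseConstant_comp_gridFloor hT n,
    fun n t ht => hω _ (gridFloor_mem hT n ht), fun n => ?_, ?_⟩
  · exact eVariationOn.comp_le_of_monotoneOn ω _ ((gridFloor_monotone hT n).monotoneOn _)
      fun t ht => gridFloor_mem hT n ht
  · obtain ⟨p, q, hp, hq, hpq⟩ := h.locallyBoundedVariationOn.exists_monotoneOn_sub_monotoneOn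
    filter_upwards [hp.countable_not_continuousWithinAt.ae_notMem volume,
      hq.countable_not_continuousWithinAt.ae_notMem volume] with t htp htq ht
    have hc : ContinuousWithinAt ω (Set.Icc 0 T) t := by
      have h1 : ContinuousWithinAt p (Set.Icc 0 T) t := by_contra fun h => htp ⟨ht, h⟩
      have h2 : ContinuousWithinAt q (Set.Icc 0 T) t := by_contra fun h => htq ⟨ht, h⟩
      rw [hpq]
      exact h1.sub h2
    refine hc.tendsto.comp (tendsto_nhdsWithin_iff.2 ⟨tendsto_gridFloor hT ht.1,
      Eventually.of_forall fun n => gridFloor_mem hT n ht⟩)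

lemma IsApproximation.boundedVariationOn {α : ℝ} {u : ℕ → ℝ → ℝ} (hu : IsApproximation T α ω u)
    (h : BoundedVariationOn ω (Set.Icc 0 T)) (n : ℕ) : BoundedVariationOn (u n) (Set.Icc 0 T) :=
  ne_top_of_le_ne_top h (hu.variation_le n)

/-- Convergence at a single point `r`, with the common bound on the variations, dominates `|u n -
ω|` by `2 V + 1` for large `n`. -/
theorem IsApproximation.tendsto_integral (hT : 0 < T) {α : ℝ} {u : ℕ → ℝ → ℝ}
    (hu : IsApproximation T α ω u) (h : BoundedVariationOn ω (Set.Icc 0 T)) :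
    Tendsto (fun n => ∫ s in (0 : ℝ)..T,
      |(Set.Icc 0 T).indicator (u n) s - (Set.Icc 0 T).indicator ω s|) atTop (𝓝 0) := by
  set V := (eVariationOn ω (Set.Icc 0 T)).toReal with hV
  obtain ⟨r, hrT, hr⟩ : ∃ r ∈ Set.Icc 0 T, Tendsto (fun n => u n r) atTop (𝓝 (ω r)) := by
    have hf : ∃ᵐ r : ℝ, r ∈ Set.Icc 0 T := by
      rw [frequently_ae_mem_iff]
      simp [hT]
    obtain ⟨r, h1, h2⟩ := (hu.tendsto.and_frequently hf).exists
    exact ⟨r, h2, h1 h2⟩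
  have hsub : Set.uIoc 0 T ⊆ Set.Icc 0 T := by
    rw [Set.uIoc_of_le hT.le]; exact Set.Ioc_subset_Icc_self
  rw [show 𝓝 (0 : ℝ) = 𝓝 (∫ s in (0 : ℝ)..T, (0 : ℝ)) by simp]
  refine intervalIntegral.tendsto_integral_filter_of_dominated_convergence (fun _ => 2 * V + 1)
    (Eventually.of_forall fun n => ?_) ?_ intervalIntegrable_const ?_
  · exact ((isFrequency_indicator (hu.boundedVariationOn h n)).sub
      (isFrequency_indicator h)).aemeasurable.norm.aestronglyMeasurable.restrict
  · filter_upwards [Metric.tendsto_nhds.1 hr 1 one_pos] with n hn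
    refine Eventually.of_forall fun s hs => ?_
    rw [Set.indicator_of_mem (hsub hs), Set.indicator_of_mem (hsub hs), Real.norm_eq_abs, abs_abs]
    have h1 := BoundedVariationOn.abs_sub_le h hrT (hsub hs)
    have h2 := (BoundedVariationOn.abs_sub_le (hu.boundedVariationOn h n) (hsub hs) hrT).trans
      (ENNReal.toReal_mono h (hu.variation_le n))
    rw [Real.dist_eq] at hn
    calc |u n s - ω s| = |(u n s - u n r) + (u n r - ω r) + (ω r - ω s)| := by congr 1; ring
      _ ≤ |u n s - u n r| + |u n r - ω r| + |ω r - ω s| := abs_add_three _ _ _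
      _ ≤ 2 * V + 1 := by linarith
  · filter_upwards [hu.tendsto] with s hs hsT
    have h1 := ((hs (hsub hsT)).sub_const (ω s)).abs
    simpa [Set.indicator_of_mem (hsub hsT)] using h1

end Approximation

/-! ### Step frequencies and conclusion -/

lemma IsStepData.monotone {T : ℝ} {u : ℝ → ℝ} {n : ℕ} {τ c : ℕ → ℝ} (h : IsStepData T u n τ c)
    {i j : ℕ} (hij : i ≤ j) (hj : j ≤ n) : τ i ≤ τ j := by
  induction j, hij using Nat.le_induction with
  | base => exact le_rfl
  | succ j _ ih => exact (ih (by omega)).trans (h.lt j (by omega)).le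

/-- Restarted at `τ k`, the solution has constant frequency `c k` until `τ (k + 1)`, except at the
endpoints, which form a null set; uniqueness identifies it with the orbit of `U k`. -/
lemma IsWeakSolutionOn.isPiecewiseConstantEvolution {T : ℝ} {u v : ℝ → ℝ} (hv : IsFrequency v)
    (huv : Set.EqOn u v (Set.Icc 0 T)) {χ : ℝ → L2} (hχ : IsWeakSolutionOn Set.univ v χ)
    (hu : IsPiecewiseConstant T u) : IsPiecewiseConstantEvolution T u χ := by
  obtain ⟨n, τ, c, h⟩ := hu
  choose U hU hUw using fun k => exists_harmonicGroup (c k)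
  refine ⟨n, τ, c, U, h, fun k _ => hU k, fun k hk t ht => ?_⟩
  have h0 : 0 ≤ τ k := h.zero ▸ h.monotone (Nat.zero_le k) hk.le
  have hT : τ (k + 1) ≤ T := h.last ▸ h.monotone hk le_rfl
  have hmem : (0 : ℝ) ∈ Set.Icc 0 (τ (k + 1) - τ k) := ⟨le_rfl, sub_nonneg.2 (h.lt k hk).le⟩
  have h1 := (hχ.shift Set.ordConnected_univ (Set.mem_univ 0) hv (Set.mem_univ (τ k))).mono
    (Set.subset_univ (Set.Icc 0 (τ (k + 1) - τ k)))
  have h2 : IsWeakSolutionOn (Set.Icc 0 (τ (k + 1) - τ k)) (fun _ => c k)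
      fun s => χ (τ k + s) := by
    refine h1.congr_ae Set.ordConnected_Icc hmem ?_
    have hz := (Set.toFinite {(0 : ℝ), τ (k + 1) - τ k}).countable.ae_notMem volume
    filter_upwards [hz] with s hs hsI
    simp only [Set.mem_insert_iff, Set.mem_singleton_iff, not_or] at hs
    have hs0 : 0 < s := lt_of_le_of_ne hsI.1 (Ne.symm hs.1)
    have hs1 : s < τ (k + 1) - τ k := lt_of_le_of_ne hsI.2 hs.2
    rw [← huv ⟨by linarith, by linarith⟩]
    exact h.value k hk _ ⟨by linarith, by linarith⟩
  have h3 := h2.unique Set.ordConnected_Icc hmem (IsFrequency.const (c k))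
    ((hUw k (χ (τ k))).mono (Set.subset_univ _))
    (by
      -- `U k 0` is idempotent and injective, hence the identity.
      have hz := (hU k).map_add 0 0 (χ (τ k))
      rw [add_zero] at hz
      rw [add_zero]
      exact (U k 0).injective hz)
    (x := t - τ k) ⟨by linarith [ht.1], by linarith [ht.2]⟩
  simpa using h3

end HarmonicTrap

end

theorem mainTheorem10 (ψ₀ : HarmonicTrap.L2) (hψ₀ : HarmonicTrap.IsEven ψ₀)
    (T : ℝ) (hT : 0 < T) (α : ℝ) (hα : 0 < α)
    (ω : ℝ → ℝ) (hω : ∀ t ∈ Set.Icc 0 T, α < ω t)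
    (hBV : BoundedVariationOn ω (Set.Icc 0 T)) :
    ∃ ψ : ℝ → HarmonicTrap.L2,
      HarmonicTrap.IsSolution T ω ψ ∧ ψ 0 = ψ₀ ∧
      (∀ t ∈ Set.Icc 0 T, HarmonicTrap.IsEven (ψ t)) ∧
      HarmonicTrap.IsPropagatorCurve T α ω ψ₀ ψ ∧
      ∀ χ : ℝ → HarmonicTrap.L2, HarmonicTrap.IsSolution T ω χ → χ 0 = ψ₀ →
        Set.EqOn χ ψ (Set.Icc 0 T) := by
  open HarmonicTrap in
  have hS : (Set.Icc 0 T).OrdConnected := Set.ordConnected_Icc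
  have h0 : (0 : ℝ) ∈ Set.Icc 0 T := ⟨le_rfl, hT.le⟩
  have hF := isFrequency_indicator hBV
  have hind : ∀ u : ℝ → ℝ, Set.EqOn u ((Set.Icc 0 T).indicator u) (Set.Icc 0 T) :=
    fun u t ht => (Set.indicator_of_mem ht u).symm
  obtain ⟨Υ, hΥ0, hΥ⟩ := exists_propagator hF
  have hw : IsWeakSolutionOn (Set.Icc 0 T) _ _ := (hΥ ψ₀).mono (Set.subset_univ _)
  have huniq : ∀ χ, IsWeakSolutionOn (Set.Icc 0 T) ((Set.Icc 0 T).indicator ω) χ → χ 0 = ψ₀ →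
      Set.EqOn χ (fun t => Υ t ψ₀) (Set.Icc 0 T) := fun χ hχ hχ0 =>
    hχ.unique hS h0 hF hw (by rw [hχ0, hΥ0])
  refine ⟨fun t => Υ t ψ₀, ?_, hΥ0 ψ₀, fun t ht => ?_, ⟨exists_isApproximation hT hω hBV,
    fun u hu => ?_⟩, fun χ hχ hχ0 => ?_⟩
  · exact isSolution_iff.2 (hw.congr_ae hS h0
      (Filter.Eventually.of_forall fun t ht => (hind ω ht).symm))
  · exact isEven_iff_reflect_eq.2 (huniq _ hw.reflect
      (by rw [hΥ0, isEven_iff_reflect_eq.1 hψ₀]) ht)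
  · have hFu := fun n => isFrequency_indicator (hu.boundedVariationOn hBV n)
    choose Υu hΥu0 hΥu using fun n => exists_propagator (hFu n)
    refine ⟨fun n t => Υu n t ψ₀, fun n => ⟨(hΥu n ψ₀).isPiecewiseConstantEvolution (hFu n)
      (hind (u n)) (hu.piecewiseConstant n), hΥu0 n ψ₀⟩, fun t ht => ?_⟩
    exact IsWeakSolutionOn.tendsto hFu hF (hu.tendsto_integral hT hBV)
      (fun n => (hΥu n ψ₀).mono (Set.subset_univ _)) hw
      (fun n => by rw [hΥu0, hΥ0]) ht
  · exact huniq χ ((isSolution_iff.1 hχ).congr_ae hS h0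
      (Filter.Eventually.of_forall fun t ht => hind ω ht)) hχ0
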